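/- **Setting.** Let $T>0$, $p\ge 1$ and $\alpha\in(0,1)$. Let $t_i=1+iT/p$, $I_i=[t_{i-1},t_i)$ for $1\le i\le p-1$ and $I_p=[t_{p-1},t_p]$. Let $n=\lfloor m(T+1)\rfloor$. For $m<k\le n$, let $D_m(k)$ be a real-valued measurable statistic computed from the observations $X_1,\dots,X_k$ in $\mathbb{R}^d$; set $D_m(m)=0$ and $\mathbb{D}_m(t)=D_m(\lfloor mt\rfloor)$, $t\in[1,T+1]$. Let $H_0$ be the hypothesis that $X_1,\dots,X_n$ is a stretch from a stationary time series with contemporary d.f. $F$. Bootstrap replicates $\mathbb{D}_m^{[b]}=R_m(X_1,\dots,X_m,W_m^{[b]})\in\ell^\infty([1,T+1])$, $b\ge1$, are computed from the learning sample $X_1,\dots,X_m$ and from additional random elements $W_m^{[1]},W_m^{[2]},\dots$ that are i.i.d. and independent of the learning sample. Each $\sup_{t\in I_i}R_m(x,w)(t)$ is assumed to be measurable in $(x,w)$. For $i=1,\dots,p$ let recursively $$g_{i,m}^B=\inf\{x\in\mathbb{R}: F_{i,m}^B(x)\ge(1-\alpha)^{1/p}\},$$ $$F_{i,m}^B(x)=\frac{\sum_{b=1}^B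 \mathbf 1\{\sup_{I_i}\mathbb{D}_m^{[b]}\le x,\ \sup_{I_j}\mathbb{D}_m^{[b]}\le g_{j,m}^B\ \forall j<i\}}{\sum_{b=1}^B \mathbf 1\{\sup_{I_j}\mathbb{D}_m^{[b]}\le g_{j,m}^B\ \forall j<i\}},$$ and let $\tau_m^B$ be the function on $[1,T+1]$ equal to $g_{i,m}^B$ on $I_i$. **Theorem.** Assume that, under $H_0$, as $m\to\infty$, $$(\mathbb{D}_m,\mathbb{D}_m^{[1]},\mathbb{D}_m^{[2]})\leadsto(\mathbb{D}_F,\mathbb{D}_F^{[1]},\mathbb{D}_F^{[2]})\quad\text{in }\{\ell^\infty([1,T+1])\}^3,$$ where $\leadsto$ is weak convergence in the sense of Hoffmann-Jørgensen (convergence of outer expectations of bounded continuous functions to the expectation at a Borel measurable limit) and $\mathbb{D}_F^{[1]},\mathbb{D}_F^{[2]}$ are independent copies of $\mathbb{D}_F$. Assume also that $(\sup_{I_1}\mathbb{D}_F,\dots,\sup_{I_p}\mathbb{D}_F)$ has a continuous d.f. on $\mathbb{R}^p$. Then, under $H_0$, as $m,B\to\infty$, $$\Pr\Big\{\sup_{I_1}\mathbb{D}_m\le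 g_{1,m}^B\Big\}\to(1-\alpha)^{1/p},$$ for every $i\in\{2,\dots,p\}$, $$\Pr\Big\{\sup_{I_i}\mathbb{D}_m\le g_{i,m}^B\,\Big|\,\sup_{I_j}\mathbb{D}_m\le g_{j,m}^B\ \forall j<i\Big\}\to(1-\alpha)^{1/p},$$ and $$\Pr(\mathbb{D}_m\le\tau_m^B\text{ on }[1,T+1])\to1-\alpha.$$ Suppose on the other hand that the observations form, for every $m$, an arbitrary sequence of random vectors whose learning sample (the first $m$ observations) has the same law as under $H_0$, that $(W_m^{[b]})_{b\ge1}$ is still i.i.d. with the same law and independent of the learning sample, and that $\sup_{t\in[1,T+1]}\mathbb{D}_m(t)\to\infty$ in probability as $m\to\infty$. Then $$\Pr\{\exists\,t\in[1,T+1]:\mathbb{D}_m(t)>\tau_m^B(t)\}\to1\qquad\text{as }m,B\to\infty.$$ -/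

import Mathlib

open Set Filter Topology MeasureTheory ProbabilityTheory
open scoped ENNReal BoundedContinuousFunction

noncomputable section

namespace SeqMonitoring

/-! ### Weak convergence in the sense of Hoffmann-Jørgensen -/

/-- Outer expectation `E* f = inf { E U : U ≥ f, U measurable and integrable }`
of a bounded, possibly non-measurable real function. -/
def outerExpectation {Ω : Type*} [MeasurableSpace Ω] (P : Measure Ω) (f : Ω → ℝ) : ℝ :=
  sInf {r : ℝ | ∃ U : Ω → ℝ, Measurable U ∧ Integrable U P ∧ (∀ ω, f ω ≤ U ω) ∧ r = ∫ ω, U ω ∂P}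

/-- Weak convergence of (possibly non-measurable) maps `Z m : Ω → E` to a Borel measurable
limit `Z' : Ω' → E`: `E* f(Z m) → E f(Z')` for every bounded continuous `f : E → ℝ`. -/
def ConvergesWeakly {Ω Ω' E : Type*} [MeasurableSpace Ω] [MeasurableSpace Ω'] [TopologicalSpace E]
    (P : Measure Ω) (Z : ℕ → Ω → E) (Q : Measure Ω') (Z' : Ω' → E) : Prop :=
  @Measurable Ω' E _ (borel E) Z' ∧
    ∀ f : E →ᵇ ℝ, Tendsto (fun m => outerExpectation P (fun ω => f (Z m ω))) atTop
      (𝓝 (∫ ω, f (Z' ω) ∂Q))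

/-- `ℓ^∞([1, T + 1])`: the bounded real functions on `[1, T + 1]` with the supremum norm. -/
abbrev Path (T : ℝ) : Type := lp (fun _ : Icc (1 : ℝ) (T + 1) => ℝ) ∞

/-- `Z₁` and `Z₂` are independent copies of `Z₀`: the three random elements of `E` are
mutually independent and have the same law (for the Borel `σ`-field of `E`). -/
def IndependentCopies {Ω E : Type*} [MeasurableSpace Ω] [TopologicalSpace E]
    (Q : Measure Ω) (Z₀ Z₁ Z₂ : Ω → E) : Prop :=
  letI : MeasurableSpace E := borel E
  iIndepFun ![Z₀, Z₁, Z₂] Q ∧ IdentDistrib Z₁ Z₀ Q Q ∧ IdentDistrib Z₂ Z₀ Q Q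

/-! ### The data -/

/-- The first `k` terms of a sequence of observations
(`x i` is the observation with number `i + 1`). -/
def firstObs {E : Type*} (k : ℕ) (x : ℕ → E) : Fin k → E := fun j => x j

/-- The null hypothesis: the observations are a stretch from a stationary time series of
`d`-dimensional random vectors with contemporary distribution function `F`. -/
structure NullHypothesis {Ω : Type*} [MeasurableSpace Ω] (P : Measure Ω) {d : ℕ}
    (X : ℕ → Ω → Fin d → ℝ) (F : (Fin d → ℝ) → ℝ) : Prop where
  measurable : ∀ i, Measurable (X i)
  stationary : ∀ h : ℕ, P.map (fun ω i => X (i + h) ω) = P.map (fun ω i => X i ω)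
  contemporary_df : ∀ x, F x = P.real {ω | X 0 ω ≤ x}

/-- The additional sources of randomness `W b` of the resampling scheme are i.i.d. and
independent of the learning sample `L`. -/
structure ResamplingNoise {Ω S 𝓦 : Type*} [MeasurableSpace Ω] [MeasurableSpace S]
    [MeasurableSpace 𝓦] (P : Measure Ω) (L : Ω → S) (W : ℕ → Ω → 𝓦) : Prop where
  measurable : ∀ b, Measurable (W b)
  indep : iIndepFun W P
  identDistrib : ∀ b, IdentDistrib (W b) (W 0) P P
  indep_sample : IndepFun L (fun ω b => W b ω) P

/-! ### Detector functions -/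

/-- The value at `t` of the piecewise constant detector function: `D ⌊m t⌋` evaluated at the
observations number `1, …, ⌊m t⌋`, with the convention that the detector is `0` at `k = m`. -/
def detectorValue {E : Type*} (m : ℕ) (D : ∀ k : ℕ, (Fin k → E) → ℝ) (x : ℕ → E) (t : ℝ) : ℝ :=
  if ⌊(m : ℝ) * t⌋₊ ≤ m then 0 else D ⌊(m : ℝ) * t⌋₊ (firstObs _ x)

theorem memℓp_detectorValue {E : Type*} (T : ℝ) (m : ℕ) (D : ∀ k : ℕ, (Fin k → E) → ℝ)
    (x : ℕ → E) :
    Memℓp (fun t : Icc (1 : ℝ) (T + 1) => detectorValue m D x t) ∞ := by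
  refine memℓp_infty (Set.Finite.bddAbove ?_)
  refine Set.Finite.subset (Set.Finite.image
    (fun k : ℕ => ‖if k ≤ m then (0 : ℝ) else D k (firstObs k x)‖)
    (Set.finite_Iic ⌊(m : ℝ) * (T + 1)⌋₊)) ?_
  rintro _ ⟨t, rfl⟩
  exact ⟨⌊(m : ℝ) * t⌋₊, Nat.floor_mono (by gcongr; exact t.2.2), rfl⟩

/-- The detector function `t ↦ D ⌊m t⌋` as an element of `ℓ^∞([1, T + 1])`. -/
def detectorPath {E : Type*} (T : ℝ) (m : ℕ) (D : ∀ k : ℕ, (Fin k → E) → ℝ) (x : ℕ → E) :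
    Path T :=
  ⟨fun t => detectorValue m D x t, memℓp_detectorValue T m D x⟩

/-! ### The time grid -/

/-- The intervals of the uniform grid `1 = t_0 < ⋯ < t_p = T + 1`, `t_i = 1 + i T / p`:
for `i = 0, …, p - 1`, the interval `[t_i, t_{i+1})`, closed on the right when `i + 1 = p`. -/
def gridInterval (T : ℝ) {p : ℕ} (i : Fin p) : Set (Icc (1 : ℝ) (T + 1)) :=
  {t | 1 + (i : ℝ) * T / p ≤ t ∧ ((t : ℝ) < 1 + ((i : ℝ) + 1) * T / p ∨ (i : ℕ) + 1 = p)}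

/-- `sup_{t ∈ I_i} f(t)` for `f ∈ ℓ^∞([1, T + 1])`. -/
def intervalSup {T : ℝ} {p : ℕ} (f : Path T) (i : Fin p) : ℝ :=
  sSup ((fun t => f t) '' gridInterval T i)

/-- `sup_{t ∈ I_i} 𝔻_m(t)` for the detector function `𝔻_m`. -/
def detectorSup {E : Type*} (T : ℝ) {p : ℕ} (m : ℕ) (D : ∀ k : ℕ, (Fin k → E) → ℝ) (x : ℕ → E)
    (i : Fin p) : ℝ :=
  intervalSup (detectorPath T m D x) i

/-- The piecewise constant threshold function with value `g i` on the `i`-th interval. -/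
def thresholdFun (T : ℝ) {p : ℕ} (g : Fin p → ℝ) (t : Icc (1 : ℝ) (T + 1)) : ℝ :=
  ∑ i, (gridInterval T i).indicator (fun _ => g i) t

/-! ### Bootstrap estimation of the thresholds -/

/-- The quantile function `y ↦ inf {x : F x ≥ y}`. -/
def quantile (F : ℝ → ℝ) (y : ℝ) : ℝ := sInf {x : ℝ | y ≤ F x}

open Classical in
/-- The empirical d.f. of the `i`-th coordinates of those sample points among `s 0, …, s (B - 1)`
whose `j`-th coordinate is at most `g j` for all `j < i`. -/
def condEmpiricalDF {p : ℕ} (B : ℕ) (s : ℕ → Fin p → ℝ) (g : Fin p → ℝ) (i : Fin p) (x : ℝ) : ℝ :=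
  (((Finset.range B).filter fun b => s b i ≤ x ∧ ∀ j < i, s b j ≤ g j).card : ℝ) /
    (((Finset.range B).filter fun b => ∀ j < i, s b j ≤ g j).card : ℝ)

/-- The recursively estimated thresholds: the `i`-th one is the quantile of order `q` of the
conditional empirical d.f. given that the previous thresholds are not exceeded (the value `0` for
`j ≥ i` below is never used). -/
def bootThreshold {p : ℕ} (q : ℝ) (B : ℕ) (s : ℕ → Fin p → ℝ) (i : Fin p) : ℝ :=
  quantile (condEmpiricalDF B s (fun j => if _h : j < i then bootThreshold q B s j else 0) i) q
termination_by i

/-- The bootstrap thresholds `g_{i,m}^B` computed from the learning sample `x` (of size `m`) and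
the realizations `w 0, …, w (B - 1)` of the additional sources of randomness. The `b`-th bootstrap
replicate of the detector function is `R x (w b)`. -/
def estimatedThreshold {E 𝓦 : Type*} {T : ℝ} (p : ℕ) (α : ℝ) {m : ℕ}
    (R : (Fin m → E) → 𝓦 → Path T) (B : ℕ) (x : Fin m → E) (w : ℕ → 𝓦) : Fin p → ℝ :=
  bootThreshold ((1 - α) ^ ((1 : ℝ) / p)) B (fun b i => intervalSup (R x (w b)) i)

end SeqMonitoring

end

namespace SeqMonitoring

/-! ### Orthants and weak convergence in finite dimension -/

-- Put q = (1 - α)^(1/p), let V be the vector of suprema of `DF` over the p grid intervals, and let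
-- G_k(x) be the probability that the first k coordinates of V are at most those of x. Everything
-- under the null hypothesis follows from one claim: the first k detector suprema stay below their
-- estimated thresholds with probability tending to q^k. Quotients for consecutive k give the
-- conditional probabilities, and k = p gives 1 - α.
--
-- The replicates share the learning sample, hence are not independent, but pairs of them are
-- exchangeable and asymptotically independent. This suffices for a second-moment law of large
-- numbers (`integral_sq_empirical_le`, `tendsto_measureReal_empirical_sub_ge`): for fixed x the
-- proportion of replicates in an orthant tends in probability to G_k(x) as m and B grow jointly.
-- The limits of the orthant probabilities come from the portmanteau theorem, because a continuous
-- joint d.f. leaves the coordinates of V without atoms.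
--
-- The conditional quantiles of V need not be unique, so the thresholds need not converge. Instead
-- `exists_box_bootThreshold` traps them, with probability tending to one, between deterministic
-- vectors a and b for which G_k(a) and G_k(b) are close to q^k. Monotonicity then squeezes the
-- probability of no exceedance (`tendsto_measureReal_mem_orthant_of_box`); no independence between
-- detector and thresholds is needed.
--
-- Under alternatives the thresholds still depend only on the learning sample and the noise, whose
-- laws are unchanged. The same boxes therefore bound them by a constant, which the diverging
-- detector exceeds.

theorem tendsto_measureReal_forall_le {Ω Ω' ι : Type*} [MeasurableSpace Ω] [MeasurableSpace Ω']
    [Fintype ι] (P : Measure Ω) [IsProbabilityMeasure P] (Q : Measure Ω') [IsProbabilityMeasure Q]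
    {U : ℕ → Ω → ι → ℝ} {V : Ω' → ι → ℝ} (hU : ∀ m, Measurable (U m)) (hV : Measurable V)
    (hconv : ∀ f : (ι → ℝ) →ᵇ ℝ,
      Tendsto (fun m => ∫ ω, f (U m ω) ∂P) atTop (𝓝 (∫ ω, f (V ω) ∂Q)))
    (hatom : ∀ j c, Q {ω | V ω j = c} = 0) (J : Set ι) (x : ι → ℝ) :
    Tendsto (fun m => P.real {ω | ∀ j ∈ J, U m ω j ≤ x j}) atTop
      (𝓝 (Q.real {ω | ∀ j ∈ J, V ω j ≤ x j})) := by
  let μs : ℕ → ProbabilityMeasure (ι → ℝ) := fun m =>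
    ⟨P.map (U m), Measure.isProbabilityMeasure_map (hU m).aemeasurable⟩
  let μ : ProbabilityMeasure (ι → ℝ) := ⟨Q.map V, Measure.isProbabilityMeasure_map hV.aemeasurable⟩
  have hlim : Tendsto μs atTop (𝓝 μ) := by
    rw [ProbabilityMeasure.tendsto_iff_forall_integral_tendsto]
    intro f
    have h1 : ∀ m, ∫ v, f v ∂(μs m : Measure (ι → ℝ)) = ∫ ω, f (U m ω) ∂P := fun m =>
      integral_map (hU m).aemeasurable f.continuous.aestronglyMeasurable
    have h2 : ∫ v, f v ∂(μ : Measure (ι → ℝ)) = ∫ ω, f (V ω) ∂Q :=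
      integral_map hV.aemeasurable f.continuous.aestronglyMeasurable
    simp only [h1, h2]
    exact hconv f
  have hclosed : IsClosed {v : ι → ℝ | ∀ j ∈ J, v j ≤ x j} := by
    simp only [ofPred_forall]
    exact isClosed_iInter fun j => isClosed_iInter fun _ =>
      isClosed_le (continuous_apply j) continuous_const
  -- The orthant is a continuity set of the limit law: at a boundary point some coordinate equals
  -- its bound, since strict inequalities in all coordinates would put the point in the interior.
  have hfr : frontier {v : ι → ℝ | ∀ j ∈ J, v j ≤ x j} ⊆ ⋃ j, {v | v j = x j} := by
    intro v hv
    by_contra hne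
    simp only [mem_iUnion, mem_ofPred_eq, not_exists] at hne
    have hmem : v ∈ {v : ι → ℝ | ∀ j ∈ J, v j ≤ x j} := hclosed.frontier_subset hv
    refine hv.2 (mem_interior.2 ⟨⋂ j ∈ J, {v | v j < x j}, ?_, ?_, ?_⟩)
    · intro u hu j hj
      exact (mem_iInter₂.1 hu j hj).le
    · exact (Set.toFinite J).isOpen_biInter fun j _ =>
        isOpen_lt (continuous_apply j) continuous_const
    · exact mem_iInter₂.2 fun j hj => lt_of_le_of_ne (hmem j hj) (hne j)
  have hnull : (μ : Measure (ι → ℝ)) (frontier {v : ι → ℝ | ∀ j ∈ J, v j ≤ x j}) = 0 := by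
    refine measure_mono_null hfr (measure_iUnion_null fun j => ?_)
    change Q.map V _ = 0
    rw [Measure.map_apply hV (measurableSet_eq_fun (measurable_pi_apply j) measurable_const)]
    exact hatom j _
  have := (ENNReal.tendsto_toReal (measure_ne_top _ _)).comp
    (ProbabilityMeasure.tendsto_measure_of_null_frontier_of_tendsto' hlim hnull)
  convert this using 2
  · rename_i m
    change _ = (P.map (U m) _).toReal
    rw [Measure.map_apply (hU m) hclosed.measurableSet]; rfl
  · change _ = (Q.map V _).toReal
    rw [Measure.map_apply hV hclosed.measurableSet]; rfl

/-- Intermediate value theorem for t ↦ Q(A ∩ {Y ≤ t}), which is continuous because Y has no atoms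
and runs from 0 to Q(A). -/
theorem exists_measureReal_inter_le_eq {Ω : Type*} [MeasurableSpace Ω] (Q : Measure Ω)
    [IsProbabilityMeasure Q] {Y : Ω → ℝ} (hY : Measurable Y) (hatom : ∀ c, Q {ω | Y ω = c} = 0)
    (A : Set Ω) {c : ℝ} (hc0 : 0 < c) (hc1 : c < Q.real A) :
    ∃ t, Q.real (A ∩ {ω | Y ω ≤ t}) = c := by
  set κ : Measure ℝ := (Q.restrict A).map Y with hκ
  have hval : ∀ t, κ.real (Iic t) = Q.real (A ∩ {ω | Y ω ≤ t}) := by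
    intro t
    rw [hκ, measureReal_def, Measure.map_apply hY measurableSet_Iic,
      Measure.restrict_apply (hY measurableSet_Iic), inter_comm]; rfl
  have hna : ∀ t, κ {t} = 0 := by
    intro t
    rw [hκ, Measure.map_apply hY (measurableSet_singleton t)]
    exact le_antisymm ((Measure.restrict_apply_le _ _).trans (hatom t).le) zero_le
  have hcont : Continuous fun t => κ.real (Iic t) := by
    have : ∀ t, κ.real (Iic t) = ∫ y, (Iic t).indicator (1 : ℝ → ℝ) y ∂κ := fun t =>
      (integral_indicator_one measurableSet_Iic).symm
    simp only [this]
    rw [continuous_iff_continuousAt]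
    intro t
    -- For y ≠ t the indicator of `Iic s` at y is constant for s near t, and the exceptional point y
    -- = t has mass zero.
    refine continuousAt_of_dominated (bound := fun _ => 1) ?_ ?_ (integrable_const _) ?_
    · exact .of_forall fun s => (measurable_one.indicator measurableSet_Iic).aestronglyMeasurable
    · refine .of_forall fun s => .of_forall fun y => ?_
      by_cases h : y ∈ Iic s <;> simp [h]
    · have : ∀ᵐ y ∂κ, y ≠ t := measure_eq_zero_iff_ae_notMem.1 (hna t)
      filter_upwards [this] with y hy
      rcases lt_or_gt_of_ne hy with h | h
      · refine continuousAt_const.congr (f := fun _ => (1 : ℝ)) ?_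
        filter_upwards [lt_mem_nhds h] with s hs
        simp [hs.le]
      · refine continuousAt_const.congr (f := fun _ => (0 : ℝ)) ?_
        filter_upwards [gt_mem_nhds h] with s hs
        simp [hs]
  have htop : Tendsto (fun t => κ.real (Iic t)) atTop (𝓝 (Q.real A)) := by
    have := (ENNReal.tendsto_toReal (measure_ne_top _ _)).comp (tendsto_measure_Iic_atTop κ)
    rwa [hκ, Measure.map_apply hY .univ, preimage_univ, Measure.restrict_apply_univ] at this
  have hbot : Tendsto (fun t => κ.real (Ici t)) atBot (𝓝 (κ.real univ)) :=
    (ENNReal.tendsto_toReal (measure_ne_top _ _)).comp (tendsto_measure_Ici_atBot κ)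
  obtain ⟨a, ha⟩ : ∃ a, κ.real (Iic a) < c := by
    obtain ⟨a, ha⟩ := (hbot.eventually_const_lt (sub_lt_self _ hc0)).exists
    -- The bound controls the mass of the open half-line below `a`; moving to `a - 1` turns it into
    -- one for a closed half-line.
    refine ⟨a - 1, (measureReal_mono (s₂ := (Ici a)ᶜ) ?_).trans_lt ?_⟩
    · intro y hy
      simp only [mem_Iic] at hy
      simp only [compl_Ici, mem_Iio]
      linarith
    · rw [measureReal_compl measurableSet_Ici]
      linarith
  obtain ⟨b, hb⟩ := (htop.eventually_const_lt hc1).exists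
  obtain ⟨t, ht⟩ := mem_range_of_exists_le_of_exists_ge hcont ⟨a, ha.le⟩ ⟨b, hb.le⟩
  exact ⟨t, (hval t).symm.trans ht⟩

/-! ### Mean square convergence of empirical frequencies -/

open Classical in
-- The square is a double sum over pairs of centred indicators. The B diagonal terms have mean at
-- most 1 and contribute 1/B after division by B²; each off-diagonal mean is r - 2cu + c². The
-- latter vanishes in the limit when u → c and r → c², so asymptotic independence of pairs can
-- replace independence.
theorem integral_sq_empirical_le {Ω : Type*} [MeasurableSpace Ω] (P : Measure Ω)
    [IsProbabilityMeasure P] {A : ℕ → Set Ω} (hA : ∀ b, MeasurableSet (A b)) {u r c : ℝ}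
    (hc0 : 0 ≤ c) (hc1 : c ≤ 1) (hu : ∀ b, P.real (A b) = u)
    (hr : ∀ b b', b ≠ b' → P.real (A b ∩ A b') = r) {B : ℕ} (hB : 0 < B) :
    ∫ ω, ((((Finset.range B).filter fun b => ω ∈ A b).card : ℝ) / B - c) ^ 2 ∂P ≤
      1 / B + |r - 2 * c * u + c ^ 2| := by
  have hB' : (0 : ℝ) < B := by exact_mod_cast hB
  let Z : ℕ → Ω → ℝ := fun b => (A b).indicator 1
  have hZi : ∀ b, Integrable (Z b) P := fun b => (integrable_const 1).indicator (hA b)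
  have hZZ : ∀ b b' ω, Z b ω * Z b' ω = (A b ∩ A b').indicator 1 ω := by
    intro b b' ω
    by_cases h : ω ∈ A b <;> by_cases h' : ω ∈ A b' <;> simp [Z, h, h']
  have hZZi : ∀ b b', Integrable (fun ω => Z b ω * Z b' ω) P := fun b b' => by
    simp only [hZZ]; exact (integrable_const 1).indicator ((hA b).inter (hA b'))
  have hexp : ∀ b b' ω, (Z b ω - c) * (Z b' ω - c) =
      Z b ω * Z b' ω - c * Z b ω - c * Z b' ω + c ^ 2 := fun b b' ω => by ring
  have hprodi : ∀ b b', Integrable (fun ω => (Z b ω - c) * (Z b' ω - c)) P := fun b b' => by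
    simp only [hexp]
    exact (((hZZi b b').sub ((hZi b).const_mul c)).sub ((hZi b').const_mul c)).add
      (integrable_const _)
  have hprod : ∀ b b', b ≠ b' → ∫ ω, (Z b ω - c) * (Z b' ω - c) ∂P = r - 2 * c * u + c ^ 2 := by
    intro b b' h
    have e1 : ∀ b, ∫ ω, Z b ω ∂P = u := fun b => (integral_indicator_one (hA b)).trans (hu b)
    have e2 : ∫ ω, Z b ω * Z b' ω ∂P = r := by
      simp only [hZZ]
      exact (integral_indicator_one ((hA b).inter (hA b'))).trans (hr b b' h)
    simp only [hexp]
    have i1 : Integrable (fun ω => Z b ω * Z b' ω - c * Z b ω) P :=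
      (hZZi b b').sub ((hZi b).const_mul c)
    have i2 : Integrable (fun ω => Z b ω * Z b' ω - c * Z b ω - c * Z b' ω) P :=
      i1.sub ((hZi b').const_mul c)
    rw [integral_add i2 (integrable_const _), integral_sub i1 ((hZi b').const_mul c),
      integral_sub (hZZi b b') ((hZi b).const_mul c),
      integral_const_mul, integral_const_mul, e1, e1, e2]
    simp; ring
  have hdiag : ∀ b, ∫ ω, (Z b ω - c) * (Z b ω - c) ∂P ≤ 1 := by
    intro b
    refine (integral_mono (hprodi b b) (integrable_const 1) fun ω => ?_).trans (by simp)
    change (Z b ω - c) * (Z b ω - c) ≤ 1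
    by_cases h : ω ∈ A b
    · simp only [Z, indicator_of_mem h, Pi.one_apply]; nlinarith
    · simp only [Z, indicator_of_notMem h]; nlinarith
  have hterm : ∀ b b', ∫ ω, (Z b ω - c) * (Z b' ω - c) ∂P ≤
      (if b = b' then 1 else 0) + |r - 2 * c * u + c ^ 2| := by
    intro b b'
    by_cases h : b = b'
    · subst h; simpa using (hdiag b).trans (le_add_of_nonneg_right (abs_nonneg _))
    · rw [hprod b b' h]; simpa [h] using le_abs_self _
  have hrew : ∀ ω, ((((Finset.range B).filter fun b => ω ∈ A b).card : ℝ) / B - c) ^ 2 =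
      (∑ b ∈ Finset.range B, ∑ b' ∈ Finset.range B, (Z b ω - c) * (Z b' ω - c)) / (B : ℝ) ^ 2 := by
    intro ω
    have : (((Finset.range B).filter fun b => ω ∈ A b).card : ℝ) = ∑ b ∈ Finset.range B, Z b ω := by
      rw [Finset.card_filter]; push_cast
      exact Finset.sum_congr rfl fun b _ => by simp [Z, indicator]
    rw [this, ← Finset.sum_mul_sum, Finset.sum_sub_distrib]
    simp; field_simp
  simp only [hrew]
  rw [integral_div, integral_finsetSum _ fun b _ => integrable_finsetSum _ fun b' _ => hprodi b b']
  simp_rw [integral_finsetSum _ fun b' _ => hprodi _ b']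
  rw [div_le_iff₀ (by positivity)]
  refine (Finset.sum_le_sum fun b _ => Finset.sum_le_sum fun b' _ => hterm b b').trans ?_
  have : ∑ b ∈ Finset.range B, ∑ b' ∈ Finset.range B,
      ((if b = b' then (1 : ℝ) else 0) + |r - 2 * c * u + c ^ 2|) =
      B + B * (B * |r - 2 * c * u + c ^ 2|) := by
    simp only [Finset.sum_add_distrib, Finset.sum_ite_eq]
    rw [Finset.sum_congr rfl fun b hb => if_pos hb]
    simp
  rw [this]
  apply le_of_eq
  field_simp

/-! ### Conditional empirical quantiles -/

/-- The vectors whose first `k` coordinates are at most those of `x`. -/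
def orthant {p : ℕ} (k : ℕ) (x : Fin p → ℝ) : Set (Fin p → ℝ) :=
  {v | ∀ j : Fin p, (j : ℕ) < k → v j ≤ x j}

theorem measurableSet_orthant {p : ℕ} (k : ℕ) (x : Fin p → ℝ) : MeasurableSet (orthant k x) := by
  simp only [orthant, ofPred_forall]
  exact .iInter fun j => .iInter fun _ => measurableSet_le (measurable_pi_apply j) measurable_const

theorem orthant_subset_orthant {p k : ℕ} {x y : Fin p → ℝ}
    (h : ∀ j : Fin p, (j : ℕ) < k → x j ≤ y j) : orthant k x ⊆ orthant k y :=
  fun _ hv j hj => (hv j hj).trans (h j hj)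

theorem mem_orthant_succ_update {p : ℕ} {i : Fin p} {x v : Fin p → ℝ} {t : ℝ} :
    v ∈ orthant (i + 1) (Function.update x i t) ↔ v ∈ orthant i x ∧ v i ≤ t := by
  constructor
  · intro h
    refine ⟨fun j hj => ?_, by simpa using h i (Nat.lt_succ_self _)⟩
    simpa [Function.update_of_ne (Fin.ne_of_lt hj)] using h j (Nat.lt_succ_of_lt hj)
  · rintro ⟨h, hi⟩ j hj
    rcases eq_or_ne j i with rfl | hne
    · simpa using hi
    · rw [Function.update_of_ne hne]
      exact h j (lt_of_le_of_ne (Nat.lt_succ_iff.1 hj) (Fin.val_ne_of_ne hne))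

open Classical in
/-- The number of sample points among `s 0, …, s (B - 1)` in `orthant k x`. -/
noncomputable def orthantCount {p : ℕ} (B : ℕ) (s : ℕ → Fin p → ℝ) (k : ℕ) (x : Fin p → ℝ) : ℕ :=
  ((Finset.range B).filter fun b => s b ∈ orthant k x).card

theorem orthantCount_mono {p B k l : ℕ} {s : ℕ → Fin p → ℝ} {x y : Fin p → ℝ}
    (h : orthant k x ⊆ orthant l y) : orthantCount B s k x ≤ orthantCount B s l y := by
  classical
  exact Finset.card_le_card (Finset.monotone_filter_right _ fun b _ hb => h hb)

/-- Turns the thresholds into statements about counts in orthants, which are monotone in the corner.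
-/
theorem condEmpiricalDF_eq {p B : ℕ} (s : ℕ → Fin p → ℝ) (g : Fin p → ℝ) (i : Fin p) (x : ℝ) :
    condEmpiricalDF B s g i x =
      orthantCount B s (i + 1) (Function.update g i x) / orthantCount B s i g := by
  classical
  unfold condEmpiricalDF orthantCount
  congr! 4
  rw [mem_orthant_succ_update, and_comm]; rfl

theorem bootThreshold_eq {p : ℕ} (q : ℝ) (B : ℕ) (s : ℕ → Fin p → ℝ) (i : Fin p) :
    bootThreshold q B s i = quantile (condEmpiricalDF B s (bootThreshold q B s) i) q := by
  rw [bootThreshold]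
  congr 1
  funext x
  have : ∀ b, (∀ j < i, s b j ≤ if _h : j < i then bootThreshold q B s j else 0) ↔
      ∀ j < i, s b j ≤ bootThreshold q B s j := fun b =>
    forall₂_congr fun j hj => by rw [dif_pos hj]
  simp only [condEmpiricalDF, this]

/-- One recursion step of the sandwich. Replacing the random earlier thresholds by `a` or `b` moves
numerator and denominator in known directions: below t the conditional d.f. stays under q, while at
u it has reached q. -/
theorem bootThreshold_mem_Icc {p B : ℕ} {q : ℝ} (hq : 0 < q) {s : ℕ → Fin p → ℝ} {i : Fin p}
    {a b : Fin p → ℝ} {t u : ℝ}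
    (hab : ∀ j < i, a j ≤ bootThreshold q B s j ∧ bootThreshold q B s j ≤ b j)
    (ht : (orthantCount B s (i + 1) (Function.update b i t) : ℝ) < q * orthantCount B s i a)
    (hu : q * orthantCount B s i b ≤ orthantCount B s (i + 1) (Function.update a i u)) :
    t ≤ bootThreshold q B s i ∧ bootThreshold q B s i ≤ u := by
  set g := bootThreshold q B s with hg
  have hag : orthant i a ⊆ orthant i g := orthant_subset_orthant fun j hj => (hab j hj).1
  have hgb : orthant i g ⊆ orthant i b := orthant_subset_orthant fun j hj => (hab j hj).2
  have h1 : (orthantCount B s i a : ℝ) ≤ orthantCount B s i g := by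
    exact_mod_cast orthantCount_mono hag
  have h2 : (orthantCount B s i g : ℝ) ≤ orthantCount B s i b := by
    exact_mod_cast orthantCount_mono hgb
  -- The strict inequality `ht` excludes an empty conditioning sample, so the quotient is a genuine
  -- one.
  have hpos : (0 : ℝ) < orthantCount B s i g := by
    have : (0 : ℝ) < q * orthantCount B s i a := (Nat.cast_nonneg _).trans_lt ht
    exact (pos_of_mul_pos_right this hq.le).trans_le h1
  have hmem : ∀ x, x ∈ {x | q ≤ condEmpiricalDF B s g i x} ↔
      q * orthantCount B s i g ≤ orthantCount B s (i + 1) (Function.update g i x) := fun x => by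
    rw [mem_ofPred_eq, condEmpiricalDF_eq, le_div_iff₀ hpos]
  have hlow : ∀ x ∈ {x | q ≤ condEmpiricalDF B s g i x}, t ≤ x := by
    intro x hx
    by_contra! hlt
    have h3 : (orthantCount B s (i + 1) (Function.update g i x) : ℝ) ≤
        orthantCount B s (i + 1) (Function.update b i t) := by
      refine Nat.cast_le.2 (orthantCount_mono fun v hv => ?_)
      rw [mem_orthant_succ_update] at hv ⊢
      exact ⟨hgb hv.1, hv.2.trans hlt.le⟩
    have := (hmem x).1 hx
    nlinarith
  have hup : u ∈ {x | q ≤ condEmpiricalDF B s g i x} := by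
    rw [hmem]
    have h3 : (orthantCount B s (i + 1) (Function.update a i u) : ℝ) ≤
        orthantCount B s (i + 1) (Function.update g i u) := by
      refine Nat.cast_le.2 (orthantCount_mono fun v hv => ?_)
      rw [mem_orthant_succ_update] at hv ⊢
      exact ⟨hag hv.1, hv.2⟩
    nlinarith
  rw [hg, bootThreshold_eq, ← hg, quantile]
  exact ⟨le_csInf ⟨u, hup⟩ hlow, csInf_le ⟨t, hlow⟩ hup⟩

-- Measurability of the estimated thresholds

theorem measurable_orthantCount {Ω : Type*} [MeasurableSpace Ω] {p B k : ℕ}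
    {s : ℕ → Ω → Fin p → ℝ} {x : Ω → Fin p → ℝ} (hs : ∀ b, Measurable (s b))
    (hx : ∀ j : Fin p, (j : ℕ) < k → Measurable fun ω => x ω j) :
    Measurable fun ω => (orthantCount B (fun b => s b ω) k (x ω) : ℝ) := by
  classical
  simp only [orthantCount, Finset.card_filter, Nat.cast_sum, Nat.cast_ite]
  refine Finset.measurable_sum _ fun b _ => Measurable.ite ?_ measurable_const measurable_const
  have : {ω | s b ω ∈ orthant k (x ω)} =
      ⋂ j : Fin p, ⋂ _ : (j : ℕ) < k, {ω | s b ω j ≤ x ω j} := by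
    ext ω; simp [orthant]
  rw [this]
  exact .iInter fun j => .iInter fun hj =>
    measurableSet_le ((measurable_pi_apply j).comp (hs b)) (hx j hj)

theorem exists_forall_orthantCount_update_eq_zero {p : ℕ} (B : ℕ) (s : ℕ → Fin p → ℝ)
    (g : Fin p → ℝ) (i : Fin p) :
    ∃ t, ∀ x < t, orthantCount B s (i + 1) (Function.update g i x) = 0 := by
  classical
  obtain ⟨t, ht⟩ := ((Finset.range B).image fun b => s b i).finite_toSet.bddBelow
  refine ⟨t, fun x hx => Finset.card_eq_zero.2 (Finset.filter_eq_empty_iff.2 fun b hb hmem => ?_)⟩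
  have h1 : s b i ≤ x := (mem_orthant_succ_update.1 hmem).2
  have h2 : t ≤ s b i := ht (Finset.mem_coe.2 (Finset.mem_image_of_mem (fun b => s b i) hb))
  linarith

theorem exists_orthantCount_update_eq {p : ℕ} (B : ℕ) (s : ℕ → Fin p → ℝ)
    (g : Fin p → ℝ) (i : Fin p) :
    ∃ u, orthantCount B s (i + 1) (Function.update g i u) = orthantCount B s i g := by
  classical
  obtain ⟨u, hu⟩ := ((Finset.range B).image fun b => s b i).finite_toSet.bddAbove
  refine ⟨u, congrArg _ (Finset.filter_congr fun b hb => ?_)⟩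
  rw [mem_orthant_succ_update, and_iff_left]
  exact hu (Finset.mem_coe.2 (Finset.mem_image_of_mem (fun b => s b i) hb))

theorem measurable_bootThreshold {Ω : Type*} [MeasurableSpace Ω] {p B : ℕ} {q : ℝ} (hq : 0 < q)
    (hq1 : q ≤ 1) {s : ℕ → Ω → Fin p → ℝ} (hs : ∀ b, Measurable (s b)) (i : Fin p) :
    Measurable fun ω => bootThreshold q B (fun b => s b ω) i := by
  induction i using WellFoundedLT.induction with
  | ind i ih =>
  let N : Ω → ℝ := fun ω => orthantCount B (fun b => s b ω) i
    (bootThreshold q B fun b => s b ω)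
  let H : ℝ → Ω → ℝ := fun x ω => orthantCount B (fun b => s b ω) (i + 1)
    (Function.update (bootThreshold q B fun b => s b ω) i x)
  have hN : Measurable N := measurable_orthantCount hs fun j hj => ih j hj
  have hH : ∀ x, Measurable (H x) := fun x => by
    refine measurable_orthantCount hs fun j hj => ?_
    rcases eq_or_ne j i with rfl | hne
    · simp
    · simp only [Function.update_of_ne hne]
      exact ih j (lt_of_le_of_ne (Nat.lt_succ_iff.1 hj) hne)
  have hmono : ∀ ω x y, x ≤ y → H x ω ≤ H y ω := fun ω x y hxy =>
    Nat.cast_le.2 (orthantCount_mono fun v hv => by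
      rw [mem_orthant_succ_update] at hv ⊢
      exact ⟨hv.1, hv.2.trans hxy⟩)
  have hdf : ∀ ω x, condEmpiricalDF B (fun b => s b ω) (bootThreshold q B fun b => s b ω) i x =
      H x ω / N ω := fun ω x => condEmpiricalDF_eq _ _ _ _
  -- If the conditioning sample is empty, division by zero makes the d.f. vanish, so no point
  -- reaches q > 0 and the infimum of the empty set is 0. Otherwise the points reaching q form an
  -- up-set, and rational ones suffice to detect an infimum below c.
  have key : ∀ c, {ω | bootThreshold q B (fun b => s b ω) i < c} =
      ({ω | N ω ≤ 0} ∩ {_ω | (0 : ℝ) < c}) ∪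
        ({ω | 0 < N ω} ∩ ⋃ r : ℚ, {ω | (r : ℝ) < c ∧ q * N ω ≤ H r ω}) := by
    intro c
    ext ω
    simp only [mem_ofPred_eq, mem_union, mem_inter_iff, mem_iUnion]
    rw [bootThreshold_eq, quantile]
    simp only [hdf]
    rcases le_or_gt (N ω) 0 with h0 | h0
    · have hN0 : N ω = 0 := le_antisymm h0 (Nat.cast_nonneg _)
      simp [hN0, hq.not_ge]
    · simp only [h0, h0.not_ge, false_and, false_or, true_and, le_div_iff₀ h0]
      obtain ⟨t, ht⟩ := exists_forall_orthantCount_update_eq_zero B (fun b => s b ω)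
        (bootThreshold q B fun b => s b ω) i
      obtain ⟨u, hu⟩ := exists_orthantCount_update_eq B (fun b => s b ω)
        (bootThreshold q B fun b => s b ω) i
      have hbdd : BddBelow {x | q * N ω ≤ H x ω} := ⟨t, fun x hx => by
        by_contra! hlt
        have : H x ω = 0 := by simp [H, ht x hlt]
        rw [mem_ofPred_eq, this] at hx
        exact absurd (mul_pos hq h0) hx.not_gt⟩
      have hne : {x | q * N ω ≤ H x ω}.Nonempty := ⟨u, by
        have : H u ω = N ω := by simp [H, N, hu]
        rw [mem_ofPred_eq, this]
        nlinarith⟩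
      constructor
      · intro h
        obtain ⟨x, hx, hxc⟩ := exists_lt_of_csInf_lt hne h
        obtain ⟨r, hxr, hrc⟩ := exists_rat_btwn hxc
        exact ⟨r, hrc, le_trans hx (hmono ω x r hxr.le)⟩
      · rintro ⟨r, hrc, hr⟩
        exact (csInf_le hbdd hr).trans_lt hrc
  refine measurable_of_Iio fun c => ?_
  change MeasurableSet {ω | bootThreshold q B (fun b => s b ω) i < c}
  rw [key]
  refine ((measurableSet_le hN measurable_const).inter (.const _)).union
    ((measurableSet_lt measurable_const hN).inter (.iUnion fun r => ?_))
  exact (MeasurableSet.const ((r : ℝ) < c)).inter (measurableSet_le (hN.const_mul q) (hH r))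

-- Convergence of orthant frequencies and boxes for the thresholds

open Classical in
-- Markov's inequality for the squared deviation. The bound is a term in B alone plus a term in m
-- alone, so the limit is a joint one without any relation between m and B.
theorem tendsto_measureReal_empirical_sub_ge {Ω : ℕ → Type*} [∀ m, MeasurableSpace (Ω m)]
    (P : ∀ m, Measure (Ω m)) [∀ m, IsProbabilityMeasure (P m)] {S : Type*} [MeasurableSpace S]
    {s : ∀ m, ℕ → Ω m → S} (hs : ∀ m b, Measurable (s m b)) {A : Set S} (hA : MeasurableSet A)
    {c : ℝ} (hc0 : 0 ≤ c) (hc1 : c ≤ 1)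
    (hexch : ∀ m b b', b ≠ b' → IdentDistrib (fun ω => (s m b ω, s m b' ω))
      (fun ω => (s m 0 ω, s m 1 ω)) (P m) (P m))
    (h1 : Tendsto (fun m => (P m).real {ω | s m 0 ω ∈ A}) atTop (𝓝 c))
    (h2 : Tendsto (fun m => (P m).real {ω | s m 0 ω ∈ A ∧ s m 1 ω ∈ A}) atTop (𝓝 (c ^ 2)))
    {η : ℝ} (hη : 0 < η) :
    Tendsto (fun mB : ℕ × ℕ => (P mB.1).real {ω | η ≤
      |(((Finset.range mB.2).filter fun b => s mB.1 b ω ∈ A).card : ℝ) / mB.2 - c|})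
      (atTop ×ˢ atTop) (𝓝 0) := by
  let u : ℕ → ℝ := fun m => (P m).real {ω | s m 0 ω ∈ A}
  let r : ℕ → ℝ := fun m => (P m).real {ω | s m 0 ω ∈ A ∧ s m 1 ω ∈ A}
  have hlim : Tendsto (fun mB : ℕ × ℕ =>
      (1 / (mB.2 : ℝ) + |r mB.1 - 2 * c * u mB.1 + c ^ 2|) / η ^ 2) (atTop ×ˢ atTop) (𝓝 0) := by
    have e1 : Tendsto (fun m => |r m - 2 * c * u m + c ^ 2|) atTop (𝓝 0) := by
      have := ((h2.sub (h1.const_mul (2 * c))).add_const (c ^ 2)).abs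
      convert this using 2
      rw [show c ^ 2 - 2 * c * c + c ^ 2 = 0 by ring, abs_zero]
    have := ((tendsto_one_div_atTop_nhds_zero_nat (𝕜 := ℝ)).comp
      (tendsto_snd (f := (atTop : Filter ℕ)))).add (e1.comp (tendsto_fst (g := (atTop : Filter ℕ))))
    simpa using this.div_const (η ^ 2)
  refine tendsto_of_tendsto_of_tendsto_of_le_of_le' tendsto_const_nhds hlim
    (.of_forall fun _ => measureReal_nonneg) ?_
  have hBpos : ∀ᶠ mB : ℕ × ℕ in atTop ×ˢ atTop, 0 < mB.2 :=
    tendsto_snd.eventually (eventually_gt_atTop 0)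
  filter_upwards [hBpos] with ⟨m, B⟩ hB
  dsimp only at hB ⊢
  have hAm : ∀ b, MeasurableSet {ω | s m b ω ∈ A} := fun b => hs m b hA
  -- The law of a single member is read off as the first marginal of a pair with any other index.
  have hu : ∀ b, (P m).real {ω | s m b ω ∈ A} = u m := fun b => congrArg ENNReal.toReal
    ((hexch m b (b + 1) (by omega)).measure_mem_eq (measurable_fst hA))
  have hr : ∀ b b', b ≠ b' → (P m).real ({ω | s m b ω ∈ A} ∩ {ω | s m b' ω ∈ A}) = r m :=
    fun b b' h => congrArg ENNReal.toReal ((hexch m b b' h).measure_mem_eq (hA.prod hA))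
  have hint := integral_sq_empirical_le (P m) hAm hc0 hc1 hu hr hB
  have hcard : Measurable fun ω =>
      (((Finset.range B).filter fun b => ω ∈ {ω | s m b ω ∈ A}).card : ℝ) := by
    simp only [Finset.card_filter, Nat.cast_sum, Nat.cast_ite]
    exact Finset.measurable_sum _ fun b _ =>
      Measurable.ite (hAm b) measurable_const measurable_const
  have hbound : ∀ ω,
      ‖((((Finset.range B).filter fun b => ω ∈ {ω | s m b ω ∈ A}).card : ℝ) / B - c) ^ 2‖ ≤ 1 := by
    intro ω
    have hle : (((Finset.range B).filter fun b => ω ∈ {ω | s m b ω ∈ A}).card : ℝ) / B ≤ 1 := by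
      refine div_le_one_of_le₀ ?_ (Nat.cast_nonneg _)
      exact_mod_cast (Finset.card_filter_le _ _).trans (Finset.card_range B).le
    have hge : 0 ≤ (((Finset.range B).filter fun b => ω ∈ {ω | s m b ω ∈ A}).card : ℝ) / B := by
      positivity
    rw [Real.norm_eq_abs, abs_of_nonneg (sq_nonneg _), sq_le_one_iff_abs_le_one, abs_le]
    constructor <;> linarith
  have hmarkov := mul_meas_ge_le_integral_of_nonneg (μ := P m)
    (f := fun ω =>
      ((((Finset.range B).filter fun b => ω ∈ {ω | s m b ω ∈ A}).card : ℝ) / B - c) ^ 2)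
    (.of_forall fun ω => sq_nonneg _)
    (Integrable.of_bound (((hcard.div_const _).sub_const _).pow_const 2).aestronglyMeasurable 1
      (.of_forall hbound)) (η ^ 2)
  rw [le_div_iff₀ (by positivity), mul_comm]
  refine le_trans (le_of_eq ?_) (hmarkov.trans hint)
  congr 3
  ext ω
  simp only [mem_ofPred_eq]
  rw [sq_le_sq, abs_of_pos hη]

theorem tendsto_measureReal_zero_of_subset_biUnion {Ω : ℕ → Type*} [∀ m, MeasurableSpace (Ω m)]
    (P : ∀ m, Measure (Ω m)) [∀ m, IsProbabilityMeasure (P m)] {κ : Type*} (t : Finset κ)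
    {E : ∀ mB : ℕ × ℕ, Set (Ω mB.1)} {C : κ → ∀ mB : ℕ × ℕ, Set (Ω mB.1)} {l : Filter (ℕ × ℕ)}
    (hC : ∀ j ∈ t, Tendsto (fun mB => (P mB.1).real (C j mB)) l (𝓝 0))
    (hE : ∀ᶠ mB in l, E mB ⊆ ⋃ j ∈ t, C j mB) :
    Tendsto (fun mB => (P mB.1).real (E mB)) l (𝓝 0) := by
  have hsum := tendsto_finsetSum t hC
  simp only [Finset.sum_const_zero] at hsum
  refine tendsto_of_tendsto_of_tendsto_of_le_of_le' tendsto_const_nhds hsum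
    (.of_forall fun _ => measureReal_nonneg) ?_
  filter_upwards [hE] with mB h
  exact (measureReal_mono h (measure_ne_top _ _)).trans (measureReal_biUnion_finset_le _ _)

/-- The estimated thresholds are, with probability tending to one, in deterministic boxes on which
the limiting distribution function is arbitrarily close to `q ^ k`. -/
theorem exists_box_bootThreshold {Ω₀ : Type*} [MeasurableSpace Ω₀] (Q : Measure Ω₀)
    [IsProbabilityMeasure Q] {p : ℕ} {V : Ω₀ → Fin p → ℝ} (hV : Measurable V)
    (hatom : ∀ j c, Q {ω | V ω j = c} = 0) {q : ℝ} (hq0 : 0 < q) (hq1 : q < 1)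
    {Ω : ℕ → Type*} [∀ m, MeasurableSpace (Ω m)]
    (P : ∀ m, Measure (Ω m)) [∀ m, IsProbabilityMeasure (P m)]
    {s : ∀ m, ℕ → Ω m → Fin p → ℝ}
    (hfreq : ∀ (k : ℕ) (x : Fin p → ℝ) (η : ℝ), 0 < η →
      Tendsto (fun mB : ℕ × ℕ => (P mB.1).real {ω | η ≤
        |(orthantCount mB.2 (fun b => s mB.1 b ω) k x : ℝ) / mB.2 -
          Q.real {ω | V ω ∈ orthant k x}|}) (atTop ×ˢ atTop) (𝓝 0))
    (k : ℕ) (hk : k ≤ p) {ε : ℝ} (hε : 0 < ε) :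
    ∃ a b : Fin p → ℝ, (∀ j, a j ≤ b j) ∧ q ^ k - ε ≤ Q.real {ω | V ω ∈ orthant k a} ∧
      Q.real {ω | V ω ∈ orthant k b} ≤ q ^ k + ε ∧
      Tendsto (fun mB : ℕ × ℕ => (P mB.1).real {ω | ∃ j : Fin p, (j : ℕ) < k ∧
        ¬ (a j ≤ bootThreshold q mB.2 (fun b => s mB.1 b ω) j ∧
          bootThreshold q mB.2 (fun b => s mB.1 b ω) j ≤ b j)}) (atTop ×ˢ atTop) (𝓝 0) := by
  induction k generalizing ε with
  | zero =>
    refine ⟨0, 0, fun _ => le_rfl, ?_, ?_, by simp⟩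
    · simp [orthant, hε.le]
    · simp [orthant, hε.le]
  | succ k ih =>
    let G : ℕ → (Fin p → ℝ) → ℝ := fun k x => Q.real {ω | V ω ∈ orthant k x}
    let i : Fin p := ⟨k, hk⟩
    have hqk : 0 < q ^ k := pow_pos hq0 k
    -- The second inequality makes the level q G_k(a) - δ positive, the third keeps q G_k(b) + δ
    -- below G_k(a), and 4δ ≤ ε absorbs the errors accumulated in this step.
    obtain ⟨δ, hδ, hδε, hδ0, hδ1⟩ : ∃ δ > 0, 4 * δ ≤ ε ∧ (1 + q) * δ < q * q ^ k ∧
        (2 + q) * δ < q ^ k * (1 - q) := by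
      have hlim : Tendsto (fun δ : ℝ => (3 : ℝ) * δ) (𝓝[>] 0) (𝓝 0) := by
        have : Tendsto (fun δ : ℝ => (3 : ℝ) * δ) (𝓝 0) (𝓝 (3 * 0)) := tendsto_id.const_mul 3
        rw [mul_zero] at this
        exact this.mono_left nhdsWithin_le_nhds
      have e1 := hlim.eventually_lt_const (show (0 : ℝ) < 3 * ε / 4 by positivity)
      have e2 := hlim.eventually_lt_const (mul_pos hq0 hqk)
      have e3 := hlim.eventually_lt_const (mul_pos hqk (sub_pos.2 hq1))
      obtain ⟨δ, ⟨⟨h1, h2⟩, h3⟩, h4⟩ := (((e1.and e2).and e3).and self_mem_nhdsWithin).exists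
      have h4 : 0 < δ := h4
      exact ⟨δ, h4, by linarith, by nlinarith, by nlinarith⟩
    obtain ⟨a, b, hab, ha, hb, hbad⟩ := ih (Nat.le_of_succ_le hk) hδ
    change q ^ k - δ ≤ G k a at ha
    change G k b ≤ q ^ k + δ at hb
    have hGsucc : ∀ x t, {ω | V ω ∈ orthant (k + 1) (Function.update x i t)} =
        {ω | V ω ∈ orthant k x} ∩ {ω | V ω i ≤ t} := fun x t => by
      ext ω
      exact mem_orthant_succ_update (i := i)
    have hGab : G k a ≤ G k b := measureReal_mono fun ω h =>
      orthant_subset_orthant (fun j _ => hab j) h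
    have hVi : Measurable fun ω => V ω i := (measurable_pi_apply i).comp hV
    -- The new lower and upper bounds cross the corners: t is calibrated with the earlier
    -- coordinates at `b` but at level q G_k(a), and u the other way round. The margin δ leaves room
    -- for sampling error.
    obtain ⟨t, ht⟩ := exists_measureReal_inter_le_eq Q hVi (hatom i) {ω | V ω ∈ orthant k b}
      (c := q * G k a - δ) (by nlinarith) (by change _ < G k b; nlinarith)
    obtain ⟨u, hu⟩ := exists_measureReal_inter_le_eq Q hVi (hatom i) {ω | V ω ∈ orthant k a}
      (c := q * G k b + δ) (by nlinarith) (by change _ < G k a; nlinarith)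
    rw [← hGsucc] at ht hu
    change G (k + 1) (Function.update b i t) = _ at ht
    change G (k + 1) (Function.update a i u) = _ at hu
    -- Exchanging the corners `a` and `b` costs at most G_k(b) - G_k(a) ≤ 2δ.
    have hdiff : ∀ v, G (k + 1) (Function.update b i v) ≤
        G (k + 1) (Function.update a i v) + (G k b - G k a) := by
      intro v
      have hsub : {ω | V ω ∈ orthant k a} ⊆ {ω | V ω ∈ orthant k b} := fun ω h =>
        orthant_subset_orthant (fun j _ => hab j) h
      have hd := measureReal_sdiff (μ := Q) hsub (hV (measurableSet_orthant k a))
      change _ = G k b - G k a at hd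
      rw [← hd]
      refine (measureReal_mono ?_).trans (measureReal_union_le _ _)
      intro ω hω
      by_cases h : V ω ∈ orthant k a
      · left
        rw [hGsucc] at hω ⊢
        exact ⟨h, hω.2⟩
      · right
        rw [hGsucc] at hω
        exact ⟨hω.1, h⟩
    have hmono : ∀ x v w, v ≤ w →
        G (k + 1) (Function.update x i v) ≤ G (k + 1) (Function.update x i w) := fun x v w h => by
      refine measureReal_mono ?_
      rw [hGsucc, hGsucc]
      exact fun ω hω => ⟨hω.1, hω.2.trans h⟩
    have htu : t ≤ u := by
      by_contra! hlt
      have h1 := hmono a u t hlt.le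
      have h2 : G (k + 1) (Function.update a i t) ≤ G (k + 1) (Function.update b i t) := by
        refine measureReal_mono fun ω h => orthant_subset_orthant (fun j _ => ?_) h
        rcases eq_or_ne j i with rfl | hne
        · simp
        · simpa [Function.update_of_ne hne] using hab j
      nlinarith
    refine ⟨Function.update a i t, Function.update b i u, fun j => ?_, ?_, ?_, ?_⟩
    · rcases eq_or_ne j i with rfl | hne
      · simpa using htu
      · simpa [Function.update_of_ne hne] using hab j
    · change _ ≤ G _ _
      have := hdiff t
      have e : q * (q ^ k - δ) ≤ q * G k a := by gcongr
      rw [pow_succ]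
      nlinarith
    · change G _ _ ≤ _
      have := hdiff u
      have e : q * G k b ≤ q * (q ^ k + δ) := by gcongr
      rw [pow_succ]
      nlinarith
    · let Dv : ℕ → (Fin p → ℝ) → ∀ mB : ℕ × ℕ, Set (Ω mB.1) := fun l x mB => {ω | δ / 4 ≤
        |(orthantCount mB.2 (fun b => s mB.1 b ω) l x : ℝ) / mB.2 - G l x|}
      -- The exceptional events: an earlier threshold leaves its box, or one of the four frequencies
      -- in the sandwich is off by at least δ/4. Outside them the two errors in each comparison
      -- total less than δ.
      let C : Fin 5 → ∀ mB : ℕ × ℕ, Set (Ω mB.1) := fun r mB =>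
        ![{ω | ∃ j : Fin p, (j : ℕ) < k ∧
            ¬ (a j ≤ bootThreshold q mB.2 (fun b => s mB.1 b ω) j ∧
              bootThreshold q mB.2 (fun b => s mB.1 b ω) j ≤ b j)},
          Dv k a mB, Dv k b mB, Dv (k + 1) (Function.update b i t) mB,
          Dv (k + 1) (Function.update a i u) mB] r
      refine tendsto_measureReal_zero_of_subset_biUnion P Finset.univ (C := C) ?_ ?_
      · intro r _
        fin_cases r
        · exact hbad
        all_goals exact hfreq _ _ _ (by positivity)
      · have hBpos : ∀ᶠ mB : ℕ × ℕ in atTop ×ˢ atTop, 0 < mB.2 :=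
          tendsto_snd.eventually (eventually_gt_atTop 0)
        filter_upwards [hBpos] with ⟨m, B⟩ hB ω hω
        dsimp only at hB hω ⊢
        have hB' : (0 : ℝ) < B := by exact_mod_cast hB
        by_contra hno
        simp only [Finset.mem_univ, iUnion_true, mem_iUnion, not_exists] at hno
        have h0 := hno 0
        have h1 : ω ∉ Dv k a (m, B) := hno 1
        have h2 : ω ∉ Dv k b (m, B) := hno 2
        have h3 : ω ∉ Dv (k + 1) (Function.update b i t) (m, B) := hno 3
        have h4 : ω ∉ Dv (k + 1) (Function.update a i u) (m, B) := hno 4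
        simp only [Dv, mem_ofPred_eq, not_le, abs_lt] at h1 h2 h3 h4
        have h0 : ∀ j < i, a j ≤ bootThreshold q B (fun b => s m b ω) j ∧
            bootThreshold q B (fun b => s m b ω) j ≤ b j := by
          intro j hj
          by_contra hcon
          exact h0 ⟨j, hj, hcon⟩
        have key := bootThreshold_mem_Icc hq0 (t := t) (u := u) h0
          (by
            have : (orthantCount B (fun b => s m b ω) (k + 1) (Function.update b i t) : ℝ) / B <
                q * (orthantCount B (fun b => s m b ω) k a / B) := by nlinarith
            rwa [← mul_div_assoc, div_lt_div_iff_of_pos_right hB'] at this)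
          (by
            have : q * ((orthantCount B (fun b => s m b ω) k b : ℝ) / B) ≤
                orthantCount B (fun b => s m b ω) (k + 1) (Function.update a i u) / B := by
              nlinarith
            rwa [← mul_div_assoc, div_le_div_iff_of_pos_right hB'] at this)
        obtain ⟨j, hj, hcon⟩ := hω
        rcases eq_or_ne j i with rfl | hne
        · exact hcon (by simpa using key)
        · simp only [Function.update_of_ne hne] at hcon
          exact hcon (h0 j (lt_of_le_of_ne (Nat.lt_succ_iff.1 hj) hne))

/-! ### Weak convergence and continuous maps -/

theorem outerExpectation_eq_integral {Ω : Type*} [MeasurableSpace Ω] (P : Measure Ω) {f : Ω → ℝ}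
    (hf : Measurable f) (hi : Integrable f P) : outerExpectation P f = ∫ ω, f ω ∂P := by
  refine IsLeast.csInf_eq ⟨⟨f, hf, hi, fun _ => le_rfl, rfl⟩, ?_⟩
  rintro _ ⟨U, -, hU, hle, rfl⟩
  exact integral_mono hi hU hle

theorem measurable_comp_of_measurable_borel {Ω E F : Type*} [MeasurableSpace Ω]
    [TopologicalSpace E] [TopologicalSpace F] [MeasurableSpace F] [BorelSpace F] {Z : Ω → E}
    (hZ : @Measurable Ω E _ (borel E) Z) {Φ : E → F} (hΦ : Continuous Φ) :
    Measurable fun ω => Φ (Z ω) := by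
  let _ : MeasurableSpace E := borel E
  have : BorelSpace E := ⟨rfl⟩
  exact hΦ.measurable.comp hZ

/-- Once the images under Φ are measurable, outer expectations are ordinary integrals. -/
theorem ConvergesWeakly.tendsto_integral_comp {Ω Ω' E F : Type*} [MeasurableSpace Ω]
    [MeasurableSpace Ω'] [TopologicalSpace E] [TopologicalSpace F] [MeasurableSpace F]
    [BorelSpace F] {P : Measure Ω} [IsProbabilityMeasure P] {Z : ℕ → Ω → E} {Q : Measure Ω'}
    {Z' : Ω' → E} (h : ConvergesWeakly P Z Q Z') {Φ : E → F} (hΦ : Continuous Φ)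
    (hmeas : ∀ m, Measurable fun ω => Φ (Z m ω)) (f : F →ᵇ ℝ) :
    Tendsto (fun m => ∫ ω, f (Φ (Z m ω)) ∂P) atTop (𝓝 (∫ ω, f (Φ (Z' ω)) ∂Q)) := by
  convert h.2 (f.compContinuous ⟨Φ, hΦ⟩) using 2 with m
  · have hm : Measurable fun ω => f (Φ (Z m ω)) := f.continuous.measurable.comp (hmeas m)
    exact (outerExpectation_eq_integral P hm (Integrable.of_bound hm.aestronglyMeasurable ‖f‖
      (.of_forall fun ω => f.norm_coe_le_norm _))).symm
  · rfl

theorem IndependentCopies.comp {Ω E F : Type*} [MeasurableSpace Ω] [TopologicalSpace E]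
    [TopologicalSpace F] [MeasurableSpace F] [BorelSpace F] {Q : Measure Ω} {Z₀ Z₁ Z₂ : Ω → E}
    (h : IndependentCopies Q Z₀ Z₁ Z₂) {Φ : E → F} (hΦ : Continuous Φ) :
    IdentDistrib (fun ω => Φ (Z₁ ω)) (fun ω => Φ (Z₀ ω)) Q Q ∧
      IdentDistrib (fun ω => Φ (Z₂ ω)) (fun ω => Φ (Z₀ ω)) Q Q ∧
      IndepFun (fun ω => Φ (Z₁ ω)) (fun ω => Φ (Z₂ ω)) Q := by
  let _ : MeasurableSpace E := borel E
  have : BorelSpace E := ⟨rfl⟩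
  obtain ⟨hind, h1, h2⟩ := h
  have h12 : IndepFun Z₁ Z₂ Q := hind.indepFun (i := 1) (j := 2) (by decide)
  exact ⟨h1.comp hΦ.measurable, h2.comp hΦ.measurable, h12.comp hΦ.measurable hΦ.measurable⟩

/-- An atom of coordinate i, restricted to the event that the other coordinates are at most n, would
be a jump at c of the d.f. along the i-th direction. These events exhaust the atom as n grows. -/
theorem measure_eq_zero_of_continuous_df {Ω ι : Type*} [MeasurableSpace Ω] [Fintype ι]
    [DecidableEq ι] (Q : Measure Ω) [IsProbabilityMeasure Q] {V : Ω → ι → ℝ} (hV : Measurable V)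
    (hcont : Continuous fun x : ι → ℝ => Q.real {ω | ∀ j, V ω j ≤ x j}) (i : ι) (c : ℝ) :
    Q {ω | V ω i = c} = 0 := by
  let A : ℕ → Set Ω := fun n => {ω | V ω i = c ∧ ∀ j, j ≠ i → V ω j ≤ n}
  have hAm : ∀ n, MeasurableSet (A n) := fun n => by
    have : A n = V ⁻¹' ({v | v i = c} ∩ ⋂ j, ⋂ _ : j ≠ i, {v | v j ≤ n}) := by
      ext ω; simp [A]
    rw [this]
    exact hV ((measurableSet_eq_fun (measurable_pi_apply i) measurable_const).inter
      (.iInter fun j => .iInter fun _ => measurableSet_le (measurable_pi_apply j) measurable_const))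
  have hA : ∀ n, Q (A n) = 0 := by
    intro n
    let H : ℝ → ℝ := fun t => Q.real {ω | ∀ j, V ω j ≤ Function.update (fun _ => (n : ℝ)) i t j}
    have hH : Continuous H := hcont.comp (continuous_const.update i continuous_id)
    have hstep : ∀ t ∈ Iio c, H t + Q.real (A n) ≤ H c := by
      intro t ht
      have hdisj : Disjoint {ω | ∀ j, V ω j ≤ Function.update (fun _ => (n : ℝ)) i t j} (A n) := by
        rw [Set.disjoint_left]
        intro ω h1 h2
        have := h1 i
        rw [Function.update_self, h2.1] at this
        exact absurd ht this.not_gt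
      change Q.real _ + _ ≤ _
      rw [← measureReal_union hdisj (hAm n)]
      refine measureReal_mono ?_
      rintro ω (h | h) j
      · rcases eq_or_ne j i with rfl | hne
        · have := h j
          rw [Function.update_self] at this ⊢
          exact this.trans (le_of_lt ht)
        · have := h j
          rwa [Function.update_of_ne hne] at this ⊢
      · rcases eq_or_ne j i with rfl | hne
        · rw [Function.update_self, h.1]
        · rw [Function.update_of_ne hne]
          exact h.2 j hne
    have hlim : Tendsto (fun t => H t + Q.real (A n)) (𝓝[<] c) (𝓝 (H c + Q.real (A n))) :=
      ((hH.tendsto c).mono_left nhdsWithin_le_nhds).add_const _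
    have := le_of_tendsto hlim (eventually_mem_nhdsWithin.mono hstep)
    exact (measureReal_eq_zero_iff (measure_ne_top _ _)).1
      (le_antisymm (by linarith) measureReal_nonneg)
  refine measure_mono_null (fun ω hω => mem_iUnion.2 ?_) (measure_iUnion_null hA)
  obtain ⟨M, hM⟩ := (Set.finite_range (V ω)).bddAbove
  obtain ⟨n, hn⟩ := exists_nat_ge M
  exact ⟨n, hω, fun j _ => (hM ⟨j, rfl⟩).trans hn⟩

/-! ### Suprema over the intervals of the grid -/

theorem bddAbove_path_image {T : ℝ} (f : Path T) (A : Set (Icc (1 : ℝ) (T + 1))) :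
    BddAbove ((fun t => f t) '' A) := by
  refine ⟨‖f‖, ?_⟩
  rintro _ ⟨t, -, rfl⟩
  exact (Real.le_norm_self _).trans (lp.norm_apply_le_norm ENNReal.top_ne_zero f t)

theorem gridInterval_nonempty {T : ℝ} (hT : 0 < T) {p : ℕ} (i : Fin p) :
    (gridInterval T i).Nonempty := by
  have hp : (0 : ℝ) < p := by exact_mod_cast i.pos
  have hi : (i : ℝ) ≤ p := by exact_mod_cast i.2.le
  have h1 : (i : ℝ) * T / p ≤ T := by
    rw [div_le_iff₀ hp]; nlinarith
  have h2 : 0 ≤ (i : ℝ) * T / p := by positivity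
  refine ⟨⟨1 + i * T / p, by constructor <;> linarith⟩, le_rfl, Or.inl ?_⟩
  dsimp only
  gcongr
  linarith

theorem exists_mem_gridInterval {T : ℝ} (hT : 0 < T) {p : ℕ} (hp : 1 ≤ p)
    (t : Icc (1 : ℝ) (T + 1)) : ∃ i : Fin p, t ∈ gridInterval T i := by
  have hp' : (0 : ℝ) < p := by exact_mod_cast hp
  set y : ℝ := ((t : ℝ) - 1) * p / T with hy
  have hy0 : 0 ≤ y := div_nonneg (mul_nonneg (by linarith [t.2.1]) hp'.le) hT.le
  have ht : (t : ℝ) = 1 + y * T / p := by rw [hy]; field_simp; ring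
  have hle : ∀ z, z ≤ y → 1 + z * T / p ≤ t := fun z hz => by rw [ht]; gcongr
  rcases lt_or_ge ⌊y⌋₊ p with h | h
  · refine ⟨⟨⌊y⌋₊, h⟩, hle _ (Nat.floor_le hy0), Or.inl ?_⟩
    rw [ht]
    have := Nat.lt_floor_add_one y
    dsimp only
    gcongr
  -- Only the right endpoint T + 1 lands here; the last interval is closed to contain it.
  · refine ⟨⟨p - 1, by omega⟩, hle _ ?_, Or.inr (by simp; omega)⟩
    have h1 : ((p - 1 : ℕ) : ℝ) ≤ ⌊y⌋₊ := by exact_mod_cast (Nat.sub_le _ _).trans h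
    exact h1.trans (Nat.floor_le hy0)

theorem eq_of_mem_gridInterval {T : ℝ} (hT : 0 < T) {p : ℕ} {t : Icc (1 : ℝ) (T + 1)} {i j : Fin p}
    (hi : t ∈ gridInterval T i) (hj : t ∈ gridInterval T j) : i = j := by
  have key : ∀ {i j : Fin p}, t ∈ gridInterval T i → t ∈ gridInterval T j → ¬ i < j := by
    intro i j hi hj hlt
    have hlt' : (i : ℕ) + 1 ≤ j := hlt
    rcases hi.2 with h | h
    · have h1 : ((i : ℝ) + 1) * T / p ≤ (j : ℝ) * T / p := by
        have : (i : ℝ) + 1 ≤ j := by exact_mod_cast hlt'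
        gcongr
      linarith [hj.1]
    · omega
  exact le_antisymm (not_lt.1 (key hj hi)) (not_lt.1 (key hi hj))

theorem thresholdFun_eq {T : ℝ} (hT : 0 < T) {p : ℕ} (g : Fin p → ℝ) {t : Icc (1 : ℝ) (T + 1)}
    {i : Fin p} (hi : t ∈ gridInterval T i) : thresholdFun T g t = g i := by
  rw [thresholdFun, Finset.sum_eq_single i, indicator_of_mem hi]
  · intro j _ hne
    exact indicator_of_notMem (fun hj => hne (eq_of_mem_gridInterval hT hj hi)) _
  · simp

theorem forall_le_thresholdFun_iff {T : ℝ} (hT : 0 < T) {p : ℕ} (hp : 1 ≤ p) (f : Path T)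
    (g : Fin p → ℝ) : (∀ t, f t ≤ thresholdFun T g t) ↔ ∀ i, intervalSup f i ≤ g i := by
  constructor
  · intro h i
    refine csSup_le ((gridInterval_nonempty hT i).image _) ?_
    rintro _ ⟨t, ht, rfl⟩
    exact (h t).trans_eq (thresholdFun_eq hT g ht)
  · intro h t
    obtain ⟨i, hi⟩ := exists_mem_gridInterval hT hp t
    rw [thresholdFun_eq hT g hi]
    exact (le_csSup (bddAbove_path_image f _) (mem_image_of_mem _ hi)).trans (h i)

/-- The supremum over an interval is 1-Lipschitz for the supremum norm. -/
theorem continuous_intervalSup {T : ℝ} (hT : 0 < T) {p : ℕ} (i : Fin p) :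
    Continuous fun f : Path T => intervalSup f i := by
  refine (LipschitzWith.of_le_add (f := fun f : Path T => intervalSup f i)
    fun f g => ?_).continuous
  refine csSup_le ((gridInterval_nonempty hT i).image _) ?_
  rintro _ ⟨t, ht, rfl⟩
  have h1 : g t ≤ intervalSup g i := le_csSup (bddAbove_path_image g _) (mem_image_of_mem _ ht)
  have h2 : f t - g t ≤ dist f g := by
    rw [dist_eq_norm]
    exact (Real.le_norm_self _).trans (lp.norm_apply_le_norm ENNReal.top_ne_zero (f - g) t)
  dsimp only
  linarith

/-- The path is a step function, so the supremum over an uncountable interval is one over the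
countable set of indices ⌊mt⌋. -/
theorem measurable_detectorSup {Ω : Type*} [MeasurableSpace Ω] {d : ℕ} {T : ℝ} {p m : ℕ}
    {D : ∀ k : ℕ, (Fin k → Fin d → ℝ) → ℝ} {X : ℕ → Ω → Fin d → ℝ} (hX : ∀ i, Measurable (X i))
    (hD : ∀ k : ℕ, m < k → k ≤ ⌊(m : ℝ) * (T + 1)⌋₊ → Measurable (D k)) (i : Fin p) :
    Measurable fun ω => detectorSup T m D (fun j => X j ω) i := by
  let K : Set ℕ := (fun t : Icc (1 : ℝ) (T + 1) => ⌊(m : ℝ) * t⌋₊) '' gridInterval T i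
  have heq : ∀ ω, detectorSup T m D (fun j => X j ω) i =
      ⨆ k : K, if (k : ℕ) ≤ m then 0 else D k (firstObs k fun j => X j ω) := by
    intro ω
    rw [iSup, ← image_eq_range (fun k => if k ≤ m then 0 else D k (firstObs k fun j => X j ω)) K,
      image_image]
    rfl
  simp only [heq]
  refine Measurable.iSup fun k => ?_
  by_cases hk : (k : ℕ) ≤ m
  · simp [hk]
  · simp only [hk, if_false]
    refine (hD k (not_le.1 hk) ?_).comp (measurable_pi_lambda _ fun j => hX j)
    obtain ⟨k, t, -, rfl⟩ := k
    exact Nat.floor_mono (by gcongr; exact t.2.2)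

/-! ### Exchangeability of the replicates -/

/-- Both sides are products of the law of the learning sample with two copies of the noise law.
Allowing two probability spaces serves both for exchangeability under the null hypothesis and for
the transfer to alternatives. -/
theorem ResamplingNoise.identDistrib_pair {Ω Ω' S 𝓦 : Type*} [MeasurableSpace Ω]
    [MeasurableSpace Ω'] [MeasurableSpace S] [MeasurableSpace 𝓦] {P : Measure Ω}
    [IsProbabilityMeasure P] {P' : Measure Ω'} [IsProbabilityMeasure P'] {L : Ω → S} {L' : Ω' → S}
    {W : ℕ → Ω → 𝓦} {W' : ℕ → Ω' → 𝓦} (hW : ResamplingNoise P L W)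
    (hW' : ResamplingNoise P' L' W') (hL : IdentDistrib L' L P' P)
    (hW0 : IdentDistrib (W' 0) (W 0) P' P) {b b' : ℕ} (hb : b ≠ b') :
    IdentDistrib (fun ω => (L' ω, (W' b ω, W' b' ω))) (fun ω => (L ω, (W 0 ω, W 1 ω))) P' P := by
  have h : ∀ i j, IdentDistrib (W' i) (W j) P' P := fun i j =>
    ((hW'.identDistrib i).trans hW0).trans (hW.identDistrib j).symm
  have hev : ∀ i j : ℕ, Measurable fun w : ℕ → 𝓦 => (w i, w j) := fun i j =>
    (measurable_pi_apply i).prodMk (measurable_pi_apply j)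
  exact hL.prodMk ((h b 0).prodMk (h b' 1) (hW'.indep.indepFun hb)
    (hW.indep.indepFun zero_ne_one))
    (hW'.indep_sample.comp measurable_id (hev b b')) (hW.indep_sample.comp measurable_id (hev 0 1))

theorem ResamplingNoise.identDistrib_replicates {Ω Ω' S 𝓦 G : Type*} [MeasurableSpace Ω]
    [MeasurableSpace Ω'] [MeasurableSpace S] [MeasurableSpace 𝓦] [MeasurableSpace G]
    {P : Measure Ω} [IsProbabilityMeasure P] {P' : Measure Ω'} [IsProbabilityMeasure P']
    {L : Ω → S} {L' : Ω' → S} {W : ℕ → Ω → 𝓦} {W' : ℕ → Ω' → 𝓦} (hW : ResamplingNoise P L W)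
    (hW' : ResamplingNoise P' L' W') (hL : IdentDistrib L' L P' P)
    (hW0 : IdentDistrib (W' 0) (W 0) P' P) {ρ : S × 𝓦 → G} (hρ : Measurable ρ) {b b' : ℕ}
    (hb : b ≠ b') :
    IdentDistrib (fun ω => (ρ (L' ω, W' b ω), ρ (L' ω, W' b' ω)))
      (fun ω => (ρ (L ω, W 0 ω), ρ (L ω, W 1 ω))) P' P :=
  (hW.identDistrib_pair hW' hL hW0 hb).comp
    (u := fun z : S × 𝓦 × 𝓦 => (ρ (z.1, z.2.1), ρ (z.1, z.2.2)))
    ((hρ.comp (measurable_fst.prodMk measurable_snd.fst)).prodMk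
      (hρ.comp (measurable_fst.prodMk measurable_snd.snd)))

/-! ### Limits of the joint laws of the suprema -/

theorem tendsto_measureReal_orthant_of_convergesWeakly {Ω Ω₀ : Type*} [MeasurableSpace Ω]
    [MeasurableSpace Ω₀] {P : Measure Ω} [IsProbabilityMeasure P] {Q : Measure Ω₀}
    [IsProbabilityMeasure Q] {T : ℝ} (hT : 0 < T) {p : ℕ} {Z Z₁ Z₂ : ℕ → Ω → Path T}
    {V V₁ V₂ : Ω₀ → Path T}
    (hZ : ∀ m (i : Fin p), Measurable fun ω => intervalSup (Z m ω) i)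
    (hZ₁ : ∀ m (i : Fin p), Measurable fun ω => intervalSup (Z₁ m ω) i)
    (hZ₂ : ∀ m (i : Fin p), Measurable fun ω => intervalSup (Z₂ m ω) i)
    (hcopies : IndependentCopies Q V V₁ V₂)
    (hconv : ConvergesWeakly P (fun m ω => (Z m ω, Z₁ m ω, Z₂ m ω)) Q
      (fun ω => (V ω, V₁ ω, V₂ ω)))
    (hcont : Continuous fun x : Fin p → ℝ => Q.real {ω | ∀ i, intervalSup (V ω) i ≤ x i}) :
    Measurable (fun ω (i : Fin p) => intervalSup (V ω) i) ∧
    (∀ (j : Fin p) (c : ℝ), Q {ω | intervalSup (V ω) j = c} = 0) ∧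
    ∀ (k : ℕ) (x : Fin p → ℝ),
      Tendsto (fun m => P.real {ω | (fun i => intervalSup (Z m ω) i) ∈ orthant k x}) atTop
        (𝓝 (Q.real {ω | (fun i => intervalSup (V ω) i) ∈ orthant k x})) ∧
      Tendsto (fun m => P.real {ω | (fun i => intervalSup (Z₁ m ω) i) ∈ orthant k x}) atTop
        (𝓝 (Q.real {ω | (fun i => intervalSup (V ω) i) ∈ orthant k x})) ∧
      Tendsto (fun m => P.real {ω | (fun i => intervalSup (Z₁ m ω) i) ∈ orthant k x ∧
          (fun i => intervalSup (Z₂ m ω) i) ∈ orthant k x}) atTop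
        (𝓝 (Q.real {ω | (fun i => intervalSup (V ω) i) ∈ orthant k x} ^ 2)) := by
  let ψ : Path T → Fin p → ℝ := fun f i => intervalSup f i
  have hψ : Continuous ψ := continuous_pi fun i => continuous_intervalSup hT i
  -- All three vectors of suprema form one continuous finite-dimensional map of the triple, so only
  -- the Borel measurability of the triple as a whole is used.
  let Φ : Path T × Path T × Path T → Fin p ⊕ Fin p ⊕ Fin p → ℝ := fun z =>
    Sum.elim (ψ z.1) (Sum.elim (ψ z.2.1) (ψ z.2.2))
  have hΦ : Continuous Φ := by
    refine continuous_pi ?_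
    rintro (i | i | i)
    · exact (continuous_apply i).comp (hψ.comp continuous_fst)
    · exact (continuous_apply i).comp (hψ.comp continuous_snd.fst)
    · exact (continuous_apply i).comp (hψ.comp continuous_snd.snd)
  have hU : ∀ m, Measurable fun ω => Φ (Z m ω, Z₁ m ω, Z₂ m ω) := by
    intro m
    refine measurable_pi_lambda _ ?_
    rintro (i | i | i)
    exacts [hZ m i, hZ₁ m i, hZ₂ m i]
  have hΦV : Measurable fun ω => Φ (V ω, V₁ ω, V₂ ω) :=
    measurable_comp_of_measurable_borel hconv.1 hΦ
  have hV : Measurable fun ω => ψ (V ω) :=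
    measurable_pi_lambda _ fun i => (measurable_pi_apply (Sum.inl i)).comp hΦV
  obtain ⟨hid1, hid2, hind⟩ := hcopies.comp hψ
  have hatom : ∀ j c, Q {ω | ψ (V ω) j = c} = 0 := measure_eq_zero_of_continuous_df Q hV hcont
  have hset : ∀ (j : Fin p) (c : ℝ), MeasurableSet {v : Fin p → ℝ | v j = c} := fun j c =>
    measurableSet_eq_fun (measurable_pi_apply j) measurable_const
  have hatomΦ : ∀ j c, Q {ω | Φ (V ω, V₁ ω, V₂ ω) j = c} = 0 := by
    rintro (j | j | j) c
    · exact hatom j c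
    · exact (hid1.measure_mem_eq (hset j c)).trans (hatom j c)
    · exact (hid2.measure_mem_eq (hset j c)).trans (hatom j c)
  refine ⟨hV, hatom, fun k x => ?_⟩
  -- The set J selects which of the three blocks, and which coordinates in them, are constrained.
  have key := fun J => tendsto_measureReal_forall_le P Q hU hΦV
    (hconv.tendsto_integral_comp hΦ hU) hatomΦ J (Sum.elim x (Sum.elim x x))
  have e1 : Q.real {ω | ψ (V₁ ω) ∈ orthant k x} = Q.real {ω | ψ (V ω) ∈ orthant k x} :=
    congrArg ENNReal.toReal (hid1.measure_mem_eq (measurableSet_orthant k x))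
  have e2 : Q.real {ω | ψ (V₂ ω) ∈ orthant k x} = Q.real {ω | ψ (V ω) ∈ orthant k x} :=
    congrArg ENNReal.toReal (hid2.measure_mem_eq (measurableSet_orthant k x))
  have e12 : Q.real {ω | ψ (V₁ ω) ∈ orthant k x ∧ ψ (V₂ ω) ∈ orthant k x} =
      Q.real {ω | ψ (V ω) ∈ orthant k x} ^ 2 := by
    have := hind.measure_inter_preimage_eq_mul _ _ (measurableSet_orthant k x)
      (measurableSet_orthant k x)
    rw [sq]
    nth_rw 1 [← e1]
    rw [← e2]
    exact (congrArg ENNReal.toReal this).trans ENNReal.toReal_mul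
  refine ⟨?_, ?_, ?_⟩
  · convert key {j | Sum.elim (fun i : Fin p => (i : ℕ) < k) (fun _ => False) j} using 4 <;>
      simp [orthant, Φ, ψ]
  · rw [← e1]
    convert key {j | Sum.elim (fun _ => False)
      (Sum.elim (fun i : Fin p => (i : ℕ) < k) (fun _ => False)) j} using 4 <;>
      simp [orthant, Φ, ψ]
  · rw [← e12]
    convert key {j | Sum.elim (fun _ => False)
      (Sum.elim (fun i : Fin p => (i : ℕ) < k) (fun i : Fin p => (i : ℕ) < k)) j} using 4 <;>
      simp [orthant, Φ, ψ]

/-- If random vectors converge in law and the random thresholds `g` are, with probability tending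
to one, in deterministic boxes on which the limiting distribution function is arbitrarily close
to `c`, then the probability that the thresholds are not exceeded tends to `c`. -/
theorem tendsto_measureReal_mem_orthant_of_box {Ω Ω₀ : Type*} [MeasurableSpace Ω]
    [MeasurableSpace Ω₀] (P : Measure Ω) [IsProbabilityMeasure P] (Q : Measure Ω₀)
    {p k : ℕ} {V : Ω₀ → Fin p → ℝ} {U : ℕ → Ω → Fin p → ℝ}
    (hU : ∀ x, Tendsto (fun m => P.real {ω | U m ω ∈ orthant k x}) atTop
      (𝓝 (Q.real {ω | V ω ∈ orthant k x})))
    {g : ℕ × ℕ → Ω → Fin p → ℝ} {c : ℝ}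
    (hbox : ∀ ε : ℝ, 0 < ε → ∃ a b : Fin p → ℝ, (∀ j, a j ≤ b j) ∧
      c - ε ≤ Q.real {ω | V ω ∈ orthant k a} ∧ Q.real {ω | V ω ∈ orthant k b} ≤ c + ε ∧
      Tendsto (fun mB => P.real {ω | ∃ j : Fin p, (j : ℕ) < k ∧
        ¬ (a j ≤ g mB ω j ∧ g mB ω j ≤ b j)}) (atTop ×ˢ atTop) (𝓝 0)) :
    Tendsto (fun mB : ℕ × ℕ => P.real {ω | U mB.1 ω ∈ orthant k (g mB ω)}) (atTop ×ˢ atTop)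
      (𝓝 c) := by
  refine tendsto_order.2 ⟨fun c' hc' => ?_, fun c' hc' => ?_⟩
  · obtain ⟨a, b, -, ha, -, hbad⟩ := hbox ((c - c') / 2) (by linarith)
    have hlim := ((hU a).comp (tendsto_fst (g := (atTop : Filter ℕ)))).sub hbad
    filter_upwards [hlim.eventually_const_lt (show c' < _ by linarith)] with mB hmB
    -- Off the bad event `a` lies below the thresholds, so the orthant at `a` is contained in the
    -- random one; only a union bound is involved.
    refine hmB.trans_le (sub_le_iff_le_add.2 ((measureReal_mono (fun ω hω => ?_)
      (measure_ne_top _ _)).trans (measureReal_union_le _ _)))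
    by_cases h : ∃ j : Fin p, (j : ℕ) < k ∧ ¬ (a j ≤ g mB ω j ∧ g mB ω j ≤ b j)
    · exact Or.inr h
    · push Not at h
      exact Or.inl (orthant_subset_orthant (fun j hj => (h j hj).1) hω)
  · obtain ⟨a, b, -, -, hb, hbad⟩ := hbox ((c' - c) / 2) (by linarith)
    have hlim := ((hU b).comp (tendsto_fst (g := (atTop : Filter ℕ)))).add hbad
    filter_upwards [hlim.eventually_lt_const (show _ < c' by linarith)] with mB hmB
    refine ((measureReal_mono (fun ω hω => ?_)
      (measure_ne_top _ _)).trans (measureReal_union_le _ _)).trans_lt hmB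
    by_cases h : ∃ j : Fin p, (j : ℕ) < k ∧ ¬ (a j ≤ g mB ω j ∧ g mB ω j ≤ b j)
    · exact Or.inr h
    · push Not at h
      exact Or.inl (orthant_subset_orthant (fun j hj => (h j hj).2) hω)

/-- The box property of the estimated thresholds, for any sequence of samples whose pairs of
members have the same law as pairs of reference vectors with asymptotically independent
components. -/
theorem exists_box_of_identDistrib {Ω₀ Ω₁ : Type*} [MeasurableSpace Ω₀] [MeasurableSpace Ω₁]
    (Q : Measure Ω₀) [IsProbabilityMeasure Q] (P : Measure Ω₁) {p : ℕ}
    {V : Ω₀ → Fin p → ℝ} (hV : Measurable V) (hatom : ∀ j c, Q {ω | V ω j = c} = 0)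
    {q : ℝ} (hq0 : 0 < q) (hq1 : q < 1) {r : ℕ → ℕ → Ω₁ → Fin p → ℝ}
    (h1 : ∀ k x, Tendsto (fun m => P.real {ω | r m 0 ω ∈ orthant k x}) atTop
      (𝓝 (Q.real {ω | V ω ∈ orthant k x})))
    (h2 : ∀ k x, Tendsto (fun m => P.real {ω | r m 0 ω ∈ orthant k x ∧ r m 1 ω ∈ orthant k x})
      atTop (𝓝 (Q.real {ω | V ω ∈ orthant k x} ^ 2)))
    {Ω : ℕ → Type*} [∀ m, MeasurableSpace (Ω m)]
    (P' : ∀ m, Measure (Ω m)) [∀ m, IsProbabilityMeasure (P' m)]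
    {s : ∀ m, ℕ → Ω m → Fin p → ℝ} (hs : ∀ m b, Measurable (s m b))
    (hid : ∀ m b b', b ≠ b' → IdentDistrib (fun ω => (s m b ω, s m b' ω))
      (fun ω => (r m 0 ω, r m 1 ω)) (P' m) P)
    {k : ℕ} (hk : k ≤ p) {ε : ℝ} (hε : 0 < ε) :
    ∃ a b : Fin p → ℝ, (∀ j, a j ≤ b j) ∧ q ^ k - ε ≤ Q.real {ω | V ω ∈ orthant k a} ∧
      Q.real {ω | V ω ∈ orthant k b} ≤ q ^ k + ε ∧
      Tendsto (fun mB : ℕ × ℕ => (P' mB.1).real {ω | ∃ j : Fin p, (j : ℕ) < k ∧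
        ¬ (a j ≤ bootThreshold q mB.2 (fun b => s mB.1 b ω) j ∧
          bootThreshold q mB.2 (fun b => s mB.1 b ω) j ≤ b j)}) (atTop ×ˢ atTop) (𝓝 0) := by
  refine exists_box_bootThreshold Q hV hatom hq0 hq1 P' (fun l x η hη => ?_) k hk hε
  have hm := measurableSet_orthant l x
  refine tendsto_measureReal_empirical_sub_ge P' hs hm measureReal_nonneg measureReal_le_one
    (fun m b b' h => (hid m b b' h).trans (hid m 0 1 zero_ne_one).symm) ?_ ?_ hη
  · refine (h1 l x).congr fun m => (congrArg ENNReal.toReal ?_).symm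
    exact (hid m 0 1 zero_ne_one).measure_mem_eq (measurable_fst hm)
  · refine (h2 l x).congr fun m => (congrArg ENNReal.toReal ?_).symm
    exact (hid m 0 1 zero_ne_one).measure_mem_eq (hm.prod hm)

theorem measureReal_cond_of_measurableSet {Ω : Type*} [MeasurableSpace Ω] (P : Measure Ω)
    {A : Set Ω} (hA : MeasurableSet A) (B : Set Ω) :
    (ProbabilityTheory.cond P A).real B = P.real (A ∩ B) / P.real A := by
  rw [measureReal_def, cond_apply hA, ENNReal.toReal_mul, ENNReal.toReal_inv, div_eq_inv_mul]; rfl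

end SeqMonitoring

-- The null hypothesis and the alternatives

open SeqMonitoring

theorem theorem3p1
    {Ω : Type*} [MeasurableSpace Ω] (P : Measure Ω) [IsProbabilityMeasure P]
    {ΩF : Type*} [MeasurableSpace ΩF] (Q : Measure ΩF) [IsProbabilityMeasure Q]
    {d : ℕ} (T : ℝ) (hT : 0 < T) (p : ℕ) (hp : 1 ≤ p) (α : ℝ) (hα0 : 0 < α) (hα1 : α < 1)
    -- the observations, which satisfy the null hypothesis under `P`
    (X : ℕ → Ω → Fin d → ℝ) (F : (Fin d → ℝ) → ℝ) (hX : SeqMonitoring.NullHypothesis P X F)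
    -- the detectors: `D m k` is a statistic of the first `k` observations
    (D : ∀ (_m k : ℕ), (Fin k → Fin d → ℝ) → ℝ)
    (hD : ∀ m k : ℕ, m < k → k ≤ ⌊(m : ℝ) * (T + 1)⌋₊ → Measurable (D m k))
    -- the resampling scheme: a replicate is computed from the learning sample and from noise
    {𝓦 : ℕ → Type*} [∀ m, MeasurableSpace (𝓦 m)]
    (R : ∀ m : ℕ, (Fin m → Fin d → ℝ) → 𝓦 m → SeqMonitoring.Path T)
    (hR : ∀ (m : ℕ) (i : Fin p), Measurable fun z : (Fin m → Fin d → ℝ) × 𝓦 m =>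
      SeqMonitoring.intervalSup (R m z.1 z.2) i)
    (W : ∀ m : ℕ, ℕ → Ω → 𝓦 m)
    (hW : ∀ m, SeqMonitoring.ResamplingNoise P
      (fun ω => SeqMonitoring.firstObs m (fun i => X i ω)) (W m))
    -- the weak limit and its two independent copies
    (DF DF1 DF2 : ΩF → SeqMonitoring.Path T)
    (hcopies : SeqMonitoring.IndependentCopies Q DF DF1 DF2)
    (hconv : SeqMonitoring.ConvergesWeakly P
      (fun m ω => (SeqMonitoring.detectorPath T m (D m) (fun i => X i ω),
        R m (SeqMonitoring.firstObs m (fun i => X i ω)) (W m 0 ω),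
        R m (SeqMonitoring.firstObs m (fun i => X i ω)) (W m 1 ω)))
      Q (fun ω => (DF ω, DF1 ω, DF2 ω)))
    (hcont : Continuous fun x : Fin p → ℝ =>
      Q.real {ω | ∀ i : Fin p, SeqMonitoring.intervalSup (DF ω) i ≤ x i}) :
    -- under the null hypothesis
    (Tendsto (fun mB : ℕ × ℕ => P.real {ω |
            SeqMonitoring.detectorSup T mB.1 (D mB.1) (fun i => X i ω) ⟨0, hp⟩ ≤
            SeqMonitoring.estimatedThreshold p α (R mB.1) mB.2
              (SeqMonitoring.firstObs mB.1 (fun i => X i ω)) (fun b => W mB.1 b ω) ⟨0, hp⟩})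
        (atTop ×ˢ atTop) (𝓝 ((1 - α) ^ ((1 : ℝ) / p))) ∧
      (∀ i : Fin p, 0 < (i : ℕ) →
        Tendsto (fun mB : ℕ × ℕ =>
            (ProbabilityTheory.cond P {ω | ∀ j < i,
            SeqMonitoring.detectorSup T mB.1 (D mB.1) (fun i => X i ω) j ≤
            SeqMonitoring.estimatedThreshold p α (R mB.1) mB.2
              (SeqMonitoring.firstObs mB.1 (fun i => X i ω)) (fun b => W mB.1 b ω) j}).real
              {ω |
            SeqMonitoring.detectorSup T mB.1 (D mB.1) (fun i => X i ω) i ≤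
            SeqMonitoring.estimatedThreshold p α (R mB.1) mB.2
              (SeqMonitoring.firstObs mB.1 (fun i => X i ω)) (fun b => W mB.1 b ω) i})
          (atTop ×ˢ atTop) (𝓝 ((1 - α) ^ ((1 : ℝ) / p)))) ∧
      Tendsto (fun mB : ℕ × ℕ => P.real {ω | ∀ t : Icc (1 : ℝ) (T + 1),
            SeqMonitoring.detectorPath T mB.1 (D mB.1) (fun i => X i ω) t ≤
              SeqMonitoring.thresholdFun T (SeqMonitoring.estimatedThreshold p α (R mB.1) mB.2
              (SeqMonitoring.firstObs mB.1 (fun i => X i ω)) (fun b => W mB.1 b ω)) t})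
        (atTop ×ˢ atTop) (𝓝 (1 - α))) ∧
    -- under alternatives: for every `m`, observations `Y m` whose learning sample
    -- (the first `m` observations) has the same law as under the null hypothesis
    (∀ {Ω' : ℕ → Type*} [∀ m, MeasurableSpace (Ω' m)] (P' : ∀ m, Measure (Ω' m))
        [∀ m, IsProbabilityMeasure (P' m)]
        (Y : ∀ m : ℕ, ℕ → Ω' m → Fin d → ℝ) (W' : ∀ m : ℕ, ℕ → Ω' m → 𝓦 m),
      (∀ m i, Measurable (Y m i)) →
      (∀ m, IdentDistrib (fun ω => SeqMonitoring.firstObs m (fun i => Y m i ω))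
        (fun ω => SeqMonitoring.firstObs m (fun i => X i ω)) (P' m) P) →
      (∀ m, SeqMonitoring.ResamplingNoise (P' m)
        (fun ω => SeqMonitoring.firstObs m (fun i => Y m i ω)) (W' m)) →
      (∀ m, IdentDistrib (W' m 0) (W m 0) (P' m) P) →
      (∀ M : ℝ, Tendsto (fun m => (P' m).real {ω |
          M < ⨆ t, SeqMonitoring.detectorPath T m (D m) (fun i => Y m i ω) t}) atTop (𝓝 1)) →
      Tendsto (fun mB : ℕ × ℕ => (P' mB.1).real {ω | ∃ t : Icc (1 : ℝ) (T + 1),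
          SeqMonitoring.thresholdFun T
              (SeqMonitoring.estimatedThreshold p α (R mB.1) mB.2
                (SeqMonitoring.firstObs mB.1 (fun i => Y mB.1 i ω)) (fun b => W' mB.1 b ω)) t <
            SeqMonitoring.detectorPath T mB.1 (D mB.1) (fun i => Y mB.1 i ω) t})
        (atTop ×ˢ atTop) (𝓝 1)) := by
  have hp0 : (0 : ℝ) < p := by exact_mod_cast hp
  have hα : 0 < 1 - α := by linarith
  set q : ℝ := (1 - α) ^ ((1 : ℝ) / p) with hq
  have hq0 : 0 < q := Real.rpow_pos_of_pos hα _
  have hq1 : q < 1 := Real.rpow_lt_one hα.le (by linarith) (by positivity)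
  have hqp : q ^ p = 1 - α := by
    rw [hq, one_div, Real.rpow_inv_natCast_pow hα.le (by omega)]
  have hL : ∀ m, Measurable fun ω => firstObs m (fun i => X i ω) := fun m =>
    measurable_pi_lambda _ fun j => hX.measurable j
  let ρ : ∀ m, (Fin m → Fin d → ℝ) × 𝓦 m → Fin p → ℝ := fun m z i => intervalSup (R m z.1 z.2) i
  have hρ : ∀ m, Measurable (ρ m) := fun m => measurable_pi_lambda _ (hR m)
  let s : ∀ _m : ℕ, ℕ → Ω → Fin p → ℝ := fun m b ω => ρ m (firstObs m (fun i => X i ω), W m b ω)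
  have hs : ∀ m b, Measurable (s m b) := fun m b =>
    (hρ m).comp ((hL m).prodMk ((hW m).measurable b))
  let S : ℕ → Ω → Fin p → ℝ := fun m ω i => detectorSup T m (D m) (fun i => X i ω) i
  have hS : ∀ m, Measurable (S m) := fun m =>
    measurable_pi_lambda _ fun i => measurable_detectorSup hX.measurable (hD m) i
  obtain ⟨hV, hatom, hlim⟩ := tendsto_measureReal_orthant_of_convergesWeakly hT (P := P) (Q := Q)
    (Z := fun m ω => detectorPath T m (D m) (fun i => X i ω))
    (Z₁ := fun m ω => R m (firstObs m (fun i => X i ω)) (W m 0 ω))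
    (Z₂ := fun m ω => R m (firstObs m (fun i => X i ω)) (W m 1 ω))
    (fun m i => (measurable_pi_apply i).comp (hS m))
    (fun m i => (measurable_pi_apply i).comp (hs m 0))
    (fun m i => (measurable_pi_apply i).comp (hs m 1)) hcopies hconv hcont
  have hlim1 := fun k x => (hlim k x).2.1
  have hlim2 := fun k x => (hlim k x).2.2
  constructor
  · let g : ℕ × ℕ → Ω → Fin p → ℝ := fun mB ω => estimatedThreshold p α (R mB.1) mB.2
      (firstObs mB.1 (fun i => X i ω)) (fun b => W mB.1 b ω)
    have hg : ∀ mB i, Measurable fun ω => g mB ω i := fun mB i =>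
      measurable_bootThreshold hq0 hq1.le (s := s mB.1) (hs mB.1) i
    have hk : ∀ k ≤ p, Tendsto (fun mB : ℕ × ℕ => P.real {ω | S mB.1 ω ∈ orthant k (g mB ω)})
        (atTop ×ˢ atTop) (𝓝 (q ^ k)) := fun k hk =>
      tendsto_measureReal_mem_orthant_of_box P Q (fun x => (hlim k x).1) fun ε hε =>
        exists_box_of_identDistrib Q P hV hatom hq0 hq1 (r := s) hlim1 hlim2 (fun _ => P) hs
          (fun m b b' h => (hW m).identDistrib_replicates (hW m)
          (IdentDistrib.refl (hL m).aemeasurable)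
          (IdentDistrib.refl ((hW m).measurable 0).aemeasurable) (hρ m) h) hk hε
    refine ⟨?_, fun i _ => ?_, ?_⟩
    · refine ((pow_one q) ▸ hk 1 hp).congr fun mB => congrArg P.real ?_
      ext ω
      exact ⟨fun h => h ⟨0, hp⟩ Nat.one_pos, fun h j hj => by
        obtain rfl : j = ⟨0, hp⟩ := Fin.ext (Nat.lt_one_iff.1 hj)
        exact h⟩
    -- Indices start at 0, so exactly i intervals precede the i-th one and the limit is q^(i+1) /
    -- q^i.
    · have h1 := (hk (i + 1) i.2).div (hk i i.2.le) (pow_ne_zero _ hq0.ne')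
      rw [pow_succ, mul_div_cancel_left₀ _ (pow_ne_zero _ hq0.ne')] at h1
      refine h1.congr fun mB => ?_
      have hm : MeasurableSet {ω | ∀ j < i, S mB.1 ω j ≤ g mB ω j} := by
        simp only [ofPred_forall]
        exact .iInter fun j => .iInter fun _ =>
          measurableSet_le ((measurable_pi_apply j).comp (hS mB.1)) (hg mB j)
      refine Eq.trans ?_ (measureReal_cond_of_measurableSet P hm _).symm
      refine congrArg₂ (· / ·) (congrArg P.real ?_) rfl
      ext ω
      exact ⟨fun h => ⟨fun j hj => h j (Nat.lt_succ_of_lt hj), h i (Nat.lt_succ_self _)⟩,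
        fun h j hj => by
          rcases eq_or_ne j i with rfl | hne
          · exact h.2
          · exact h.1 j (lt_of_le_of_ne (Nat.lt_succ_iff.1 hj) hne)⟩
    · refine (hqp ▸ hk p le_rfl).congr fun mB => congrArg P.real ?_
      ext ω
      exact Iff.trans ⟨fun h i => h i i.2, fun h i _ => h i⟩
        (forall_le_thresholdFun_iff hT hp _ (g mB ω)).symm
  · intro Ω' _ P' _ Y W' hY hYX hW' hWW hdiv
    have hL' : ∀ m, Measurable fun ω => firstObs m (fun i => Y m i ω) := fun m =>
      measurable_pi_lambda _ fun j => hY m j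
    have hs' : ∀ m b, Measurable fun ω => ρ m (firstObs m (fun i => Y m i ω), W' m b ω) :=
      fun m b => (hρ m).comp ((hL' m).prodMk ((hW' m).measurable b))
    -- Only boundedness of the thresholds matters here, so the accuracy 1 is arbitrary and just the
    -- upper corner `b` is kept.
    obtain ⟨a, b, -, -, -, hbad⟩ := exists_box_of_identDistrib Q P hV hatom hq0 hq1 (r := s)
      hlim1 hlim2 P' hs' (fun m b b' h =>
      (hW m).identDistrib_replicates (hW' m) (hYX m) (hWW m) (hρ m) h) le_rfl one_pos
    obtain ⟨M, hM⟩ := (Set.finite_range b).bddAbove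
    have hlow := ((hdiv M).comp (tendsto_fst (g := (atTop : Filter ℕ)))).sub hbad
    rw [sub_zero] at hlow
    refine tendsto_of_tendsto_of_tendsto_of_le_of_le hlow tendsto_const_nhds (fun mB => ?_)
      fun mB => measureReal_le_one
    refine sub_le_iff_le_add.2 ((measureReal_mono (fun ω hω => ?_) (measure_ne_top _ _)).trans
      (measureReal_union_le _ _))
    by_cases h : ∃ j : Fin p, (j : ℕ) < p ∧
        ¬ (a j ≤ estimatedThreshold p α (R mB.1) mB.2 (firstObs mB.1 (fun i => Y mB.1 i ω))
            (fun b => W' mB.1 b ω) j ∧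
          estimatedThreshold p α (R mB.1) mB.2 (firstObs mB.1 (fun i => Y mB.1 i ω))
            (fun b => W' mB.1 b ω) j ≤ b j)
    · exact Or.inr h
    · left
      push Not at h
      have : Nonempty (Icc (1 : ℝ) (T + 1)) := ⟨⟨1, by constructor <;> linarith⟩⟩
      obtain ⟨t, ht⟩ := exists_lt_of_lt_ciSup (mem_ofPred_eq.mp hω)
      obtain ⟨i, hi⟩ := exists_mem_gridInterval hT hp t
      refine ⟨t, ?_⟩
      rw [thresholdFun_eq hT _ hi]
      exact ((h i i.2).2.trans (hM ⟨i, rfl⟩)).trans_lt ht
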